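/- **Setting.** Let $\mathcal A_0$ be the set of even real test functions $\varphi\in\mathcal D(\mathbb R)$, constant near $0$, with $\int_0^\infty\varphi=\frac12$, and for $q\in\mathbb N$ let $\mathcal A_q$ be the set of those with $\int_0^\infty x^{j/m}\varphi(x)\,dx=0$ for $1\le j,m\le q$; put $\varphi_\varepsilon(x)=\varepsilon^{-1}\varphi(x/\varepsilon)$, let $i(\varphi)$ be the diameter of $\operatorname{supp}\varphi$, and let $\Gamma$ be the set of strictly increasing sequences in $[0,\infty)$ tending to $\infty$. "For small $\varepsilon$" means for all $\varepsilon\in\,]0,\eta[$ with some $\eta>0$ that may depend on $\varphi$; constants $c>0$ may depend on $\varphi$ too. Let $\Omega\subseteq\mathbb C$ be open and non-empty. $\mathcal G(\Omega)=\mathcal E_M(\Omega)/\mathcal N(\Omega)$, where $\mathcal E_M(\Omega)$ consists of the families $(u_\varphi)_{\varphi\in\mathcal A_0}$ in $\mathcal C^\infty(\Omega;\mathbb C)$ such that for every compact $K\subset\Omega$ and every partial derivative $\partial^\alpha$ there is $N\in\mathbb N$ such that for every $\varphi\in\mathcal A_N$ one has, with some $c$, $\sup_K|\partial^\alpha u_{\varphi_\varepsilon}|\le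 c\,\varepsilon^{-N}$ for small $\varepsilon$; and $\mathcal N(\Omega)$ of those such that for all $K,\alpha$ there are $N\in\mathbb N$ and $\gamma\in\Gamma$ such that for all $q\ge N$ and $\varphi\in\mathcal A_q$ one has, with some $c$, $\sup_K|\partial^\alpha u_{\varphi_\varepsilon}|\le c\,\varepsilon^{\gamma(q)-N}$ for small $\varepsilon$. The ring $\overline{\mathbb C}$ of generalized numbers is defined in the same way from families $(v_\varphi)$ of complex numbers (no $K$, $\alpha$); $\overline{\mathbb R}\subset\overline{\mathbb C}$ is the subring of classes of real families. Let $\dot\alpha_r\in\overline{\mathbb C}$ be the class of $\varphi\mapsto i(\varphi)^r$ and $\dot\beta_s=\dot\alpha_{-\log s}$ for $s>0$. Write $x\approx0$ if for some representative $(v_\varphi)$ of $x$ and some $p$, $v_{\varphi_\varepsilon}\to0$ as $\varepsilon\downarrow0$ for all $\varphi\in\mathcal A_p$. Put $V(x)=\sup\{r\in\mathbb R:\dot\alpha_{-r}x\approx0\}$ and $\|x\|=e^{-V(x)}$. Convergence in $\overline{\mathbb C}$ and the balls $B_r(z_0)$ refer to the metric $\|x-y\|$. $\tilde\Omega_c\subset\overline{\mathbb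 C}$ is the (open) set of all $x$ that have a representative $(x_\varphi)$ with values in $\Omega$ for which there are a compact $K\subset\Omega$ and $p\in\mathbb N$ such that, for all $\varphi\in\mathcal A_p$, $x_{\varphi_\varepsilon}\in K$ for small $\varepsilon$. For $f\in\mathcal G(\Omega)$ with representative $(u_\varphi)$ let $\kappa(f):\tilde\Omega_c\to\overline{\mathbb C}$ map the class of $(x_\varphi)$ to the class of $(u_\varphi(x_\varphi))$. A function $F:\tilde\Omega_c\to\overline{\mathbb C}$ has derivative $d$ at $z_0$ if $\lim_{z\to z_0}\big(F(z)-F(z_0)-d(z-z_0)\big)/\dot\beta_{\|z-z_0\|}=0$; $F^{(n)}$ is the $n$-th iterated derivative. The partial derivatives $\partial_xF,\partial_yF$ at $z_0$ are the elements $a,b$ with $\big(F(z_0+h)-F(z_0)-ah\big)/\dot\beta_{\|h\|}\to0$ and $\big(F(z_0+ih)-F(z_0)-bh\big)/\dot\beta_{\|h\|}\to0$ as $h\to0$, $h\ne 0$, in $\overline{\mathbb R}$, and $\partial F/\partial\bar z=\frac12(\partial_x F+i\,\partial_y F)$. $F$ is *analytic* if every $z_0\in\tilde\Omega_c$ has a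 ball $B_r(z_0)\subseteq\tilde\Omega_c$, $r>0$, and coefficients $a_n\in\overline{\mathbb C}$ such that $\sum_{n\ge0}a_n(z-z_0)^n$ converges to $F(z)$ for all $z\in B_r(z_0)$. $f$ is *holomorphic* if $\bar\partial f=0$ in $\mathcal G(\Omega)$. $f$ is *sub-linear* if it has a representative $(u_\varphi)$ such that every $x\in\tilde\Omega_c$ has a representative $(x_\varphi)$ with values in $\Omega$, a number $k\in\mathbb R$ and a sequence $(p_n)$ in $\mathbb R$ with $\lim_{n\to\infty}(p_n+kn)=\infty$ such that for every $n\in\mathbb N$ there is $q\in\mathbb N$ such that for every $\varphi\in\mathcal A_q$ one has, with some $c>0$, $$\Big|\frac{\partial^n u_{\varphi_\varepsilon}}{\partial z^n}(x_{\varphi_\varepsilon})\Big|\le c\,\varepsilon^{p_n}\quad\text{for small }\varepsilon .$$ **Theorem.** Let $f\in\mathcal G(\Omega)$. (i) If $\kappa(f)$ is analytic, then $f$ is sub-linear. (ii) If $f$ is holomorphic and sub-linear, then $\kappa(f)$ is analytic; $\kappa(f)$ is infinitely differentiable on $\tilde\Omega_c$, and for every $z_0\in\tilde\Omega_c$ there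 is $r\in\,]0,1[$ such that $B_r(z_0)\subseteq\tilde\Omega_c$ and $$\kappa(f)(z)=\sum_{n\ge0}\frac{\kappa(f)^{(n)}(z_0)}{n!}(z-z_0)^n\qquad\text{for all }z\in B_r(z_0),$$ the series converging uniformly on $B_r(z_0)$; moreover $\dfrac{\partial}{\partial\bar z}\kappa(f)=0$ on $\tilde\Omega_c$. -/

import Mathlib

open Set Filter Topology
open scoped ContDiff Pointwise

noncomputable section

namespace Colombeau

/-! ### The index set -/

/-- The conditions defining `𝒜₀(ℝ)`: test functions on the line which are even, constant near the
origin and satisfy `∫₀^∞ φ = 1/2`. -/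
def IsMollifier (φ : ℝ → ℝ) : Prop :=
  ContDiff ℝ ∞ φ ∧ HasCompactSupport φ ∧ (∀ x, φ (-x) = φ x) ∧
    (∃ δ > 0, ∀ x, |x| < δ → φ x = φ 0) ∧ ∫ x in Ioi (0 : ℝ), φ x = 1 / 2

/-- The index set `𝒜₀`. -/
abbrev A0 : Type := {φ : ℝ → ℝ // IsMollifier φ}

/-- The subsets `𝒜_q` of `𝒜₀`: all the fractional moments `∫₀^∞ x^(j/m) φ(x) dx`,
`1 ≤ j, m ≤ q`, vanish. -/
def A (q : ℕ) : Set A0 :=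
  {φ | ∀ j m : ℕ, 1 ≤ j → j ≤ q → 1 ≤ m → m ≤ q →
    ∫ x in Ioi (0 : ℝ), x ^ ((j : ℝ) / (m : ℝ)) * φ.1 x = 0}

theorem A_anti {p q : ℕ} (h : p ≤ q) : A q ⊆ A p :=
  fun _ hφ j m hj hj' hm hm' => hφ j m hj (hj'.trans h) hm (hm'.trans h)

theorem IsMollifier.scale {φ : ℝ → ℝ} (hφ : IsMollifier φ) {ε : ℝ} (hε : 0 < ε) :
    IsMollifier (fun x => ε⁻¹ * φ (ε⁻¹ * x)) := by
  obtain ⟨h1, h2, h3, ⟨δ, hδ, h4⟩, h5⟩ := hφ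
  refine ⟨?_, ?_, ?_, ⟨ε * δ, by positivity, ?_⟩, ?_⟩
  · exact contDiff_const.mul (h1.comp (contDiff_const.mul contDiff_id))
  · have : HasCompactSupport (fun x : ℝ => φ (ε⁻¹ • x)) := h2.comp_smul (inv_ne_zero hε.ne')
    exact this.mul_left
  · intro x
    simp [h3]
  · intro x hx
    have : |ε⁻¹ * x| < δ := by
      rw [abs_mul, abs_of_pos (inv_pos.2 hε), inv_mul_lt_iff₀ hε]
      exact hx
    simp [h4 _ this]
  · rw [MeasureTheory.integral_const_mul,
      MeasureTheory.integral_comp_mul_left_Ioi φ 0 (inv_pos.2 hε), mul_zero, h5]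
    simp [hε.ne']

/-- `φ_ε(x) = ε⁻¹ φ(x/ε)`; it is only used for `ε > 0`. -/
def scale (ε : ℝ) (φ : A0) : A0 :=
  if h : 0 < ε then ⟨fun x => ε⁻¹ * φ.1 (ε⁻¹ * x), φ.2.scale h⟩ else φ

/-- `Γ`: the strictly increasing sequences of nonnegative reals diverging to infinity. -/
def IsGamma (γ : ℕ → ℝ) : Prop :=
  (∀ n, 0 ≤ γ n) ∧ StrictMono γ ∧ Tendsto γ atTop atTop

/-! ### Moderate and negligible families

In what follows, "for all sufficiently small `ε > 0`" (that is, for `ε ∈ ]0, η[` with some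
`η = η(φ)`) is written with the filter `𝓝[>] 0`. -/

/-- Moderate growth, uniformly on the set `s`, of a family of real functions. -/
def UModerate {X : Type} (s : Set X) (w : A0 → X → ℝ) : Prop :=
  ∃ N : ℕ, ∀ φ ∈ A N, ∃ c > 0, ∀ᶠ ε in 𝓝[>] (0 : ℝ), ∀ z ∈ s,
    w (scale ε φ) z ≤ c * ε ^ (-(N : ℝ))

/-- Negligible growth, uniformly on the set `s`, of a family of real functions. -/
def UNull {X : Type} (s : Set X) (w : A0 → X → ℝ) : Prop :=
  ∃ N : ℕ, ∃ γ : ℕ → ℝ, IsGamma γ ∧ ∀ q ≥ N, ∀ φ ∈ A q, ∃ c > 0,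
    ∀ᶠ ε in 𝓝[>] (0 : ℝ), ∀ z ∈ s, w (scale ε φ) z ≤ c * ε ^ (γ q - N)

section growth

variable {X : Type} {s : Set X} {w w₁ w₂ : A0 → X → ℝ}

theorem eventually_small : ∀ᶠ ε in 𝓝[>] (0 : ℝ), 0 < ε ∧ ε < 1 :=
  Ioo_mem_nhdsGT one_pos

theorem IsGamma.inf {γ δ : ℕ → ℝ} (hγ : IsGamma γ) (hδ : IsGamma δ) :
    IsGamma (fun n => min (γ n) (δ n)) :=
  ⟨fun n => le_min (hγ.1 n) (hδ.1 n),
    fun _ _ h => lt_min ((min_le_left _ _).trans_lt (hγ.2.1 h))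
      ((min_le_right _ _).trans_lt (hδ.2.1 h)),
    tendsto_atTop.2 fun b => by
      filter_upwards [tendsto_atTop.1 hγ.2.2 b, tendsto_atTop.1 hδ.2.2 b] with n h h'
      exact le_min h h'⟩

theorem isGamma_id : IsGamma (fun n => (n : ℝ)) :=
  ⟨fun n => n.cast_nonneg, fun _ _ h => Nat.cast_lt.2 h, tendsto_natCast_atTop_atTop⟩

theorem UModerate.mono (h : UModerate s w₂) (h' : ∀ φ, ∀ z ∈ s, w₁ φ z ≤ w₂ φ z) :
    UModerate s w₁ := by
  obtain ⟨N, h⟩ := h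
  refine ⟨N, fun φ hφ => ?_⟩
  obtain ⟨c, hc, h⟩ := h φ hφ
  refine ⟨c, hc, ?_⟩
  filter_upwards [h] with ε h z hz using (h' _ z hz).trans (h z hz)

theorem UNull.mono (h : UNull s w₂) (h' : ∀ φ, ∀ z ∈ s, w₁ φ z ≤ w₂ φ z) : UNull s w₁ := by
  obtain ⟨N, γ, hγ, h⟩ := h
  refine ⟨N, γ, hγ, fun q hq φ hφ => ?_⟩
  obtain ⟨c, hc, h⟩ := h q hq φ hφ
  refine ⟨c, hc, ?_⟩
  filter_upwards [h] with ε h z hz using (h' _ z hz).trans (h z hz)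

theorem uModerate_const (a : ℝ) : UModerate s (fun _ _ => a) := by
  refine ⟨0, fun φ _ => ⟨|a| + 1, by positivity, ?_⟩⟩
  filter_upwards with ε z _
  have := le_abs_self a
  simp
  linarith

theorem uNull_zero : UNull s (fun _ _ => 0) := by
  refine ⟨0, _, isGamma_id, fun q _ φ _ => ⟨1, one_pos, ?_⟩⟩
  filter_upwards [eventually_small] with ε hε z _
  have := Real.rpow_nonneg hε.1.le ((q : ℝ) - (0 : ℕ))
  linarith

theorem rpow_le_of_small {ε a b : ℝ} (hε : 0 < ε ∧ ε < 1) (h : b ≤ a) : ε ^ a ≤ ε ^ b :=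
  Real.rpow_le_rpow_of_exponent_ge hε.1 hε.2.le h

theorem UModerate.add (h₁ : UModerate s w₁) (h₂ : UModerate s w₂) :
    UModerate s (fun φ z => w₁ φ z + w₂ φ z) := by
  obtain ⟨N, h₁⟩ := h₁
  obtain ⟨M, h₂⟩ := h₂
  refine ⟨max N M, fun φ hφ => ?_⟩
  obtain ⟨c, hc, h₁⟩ := h₁ φ (A_anti (le_max_left _ _) hφ)
  obtain ⟨d, hd, h₂⟩ := h₂ φ (A_anti (le_max_right _ _) hφ)
  refine ⟨c + d, by positivity, ?_⟩
  filter_upwards [h₁, h₂, eventually_small] with ε h₁ h₂ hε z hz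
  have e₁ : ε ^ (-(N : ℝ)) ≤ ε ^ (-((max N M : ℕ) : ℝ)) :=
    rpow_le_of_small hε (by simp)
  have e₂ : ε ^ (-(M : ℝ)) ≤ ε ^ (-((max N M : ℕ) : ℝ)) :=
    rpow_le_of_small hε (by simp)
  rw [add_mul]
  exact add_le_add ((h₁ z hz).trans (by gcongr)) ((h₂ z hz).trans (by gcongr))

theorem UNull.add (h₁ : UNull s w₁) (h₂ : UNull s w₂) :
    UNull s (fun φ z => w₁ φ z + w₂ φ z) := by
  obtain ⟨N, γ, hγ, h₁⟩ := h₁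
  obtain ⟨M, δ, hδ, h₂⟩ := h₂
  refine ⟨max N M, _, hγ.inf hδ, fun q hq φ hφ => ?_⟩
  obtain ⟨c, hc, h₁⟩ := h₁ q ((le_max_left _ _).trans hq) φ hφ
  obtain ⟨d, hd, h₂⟩ := h₂ q ((le_max_right _ _).trans hq) φ hφ
  refine ⟨c + d, by positivity, ?_⟩
  filter_upwards [h₁, h₂, eventually_small] with ε h₁ h₂ hε z hz
  have l₁ : (N : ℝ) ≤ ((max N M : ℕ) : ℝ) := by simp
  have l₂ : (M : ℝ) ≤ ((max N M : ℕ) : ℝ) := by simp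
  have e₁ : ε ^ (γ q - N) ≤ ε ^ (min (γ q) (δ q) - ((max N M : ℕ) : ℝ)) :=
    rpow_le_of_small hε (by have := min_le_left (γ q) (δ q); linarith)
  have e₂ : ε ^ (δ q - M) ≤ ε ^ (min (γ q) (δ q) - ((max N M : ℕ) : ℝ)) :=
    rpow_le_of_small hε (by have := min_le_right (γ q) (δ q); linarith)
  rw [add_mul]
  exact add_le_add ((h₁ z hz).trans (by gcongr)) ((h₂ z hz).trans (by gcongr))

theorem UModerate.mul (h₁ : UModerate s w₁) (h₂ : UModerate s w₂)
    (n₂ : ∀ φ z, 0 ≤ w₂ φ z) :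
    UModerate s (fun φ z => w₁ φ z * w₂ φ z) := by
  obtain ⟨N, h₁⟩ := h₁
  obtain ⟨M, h₂⟩ := h₂
  refine ⟨N + M, fun φ hφ => ?_⟩
  obtain ⟨c, hc, h₁⟩ := h₁ φ (A_anti (Nat.le_add_right _ _) hφ)
  obtain ⟨d, hd, h₂⟩ := h₂ φ (A_anti (Nat.le_add_left _ _) hφ)
  refine ⟨c * d, by positivity, ?_⟩
  filter_upwards [h₁, h₂, eventually_small] with ε h₁ h₂ hε z hz
  have e : ε ^ (-((N + M : ℕ) : ℝ)) = ε ^ (-(N : ℝ)) * ε ^ (-(M : ℝ)) := by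
    rw [← Real.rpow_add hε.1]
    congr 1
    push_cast
    ring
  rw [e, mul_mul_mul_comm]
  have := Real.rpow_nonneg hε.1.le (-(N : ℝ))
  exact mul_le_mul (h₁ z hz) (h₂ z hz) (n₂ _ _) (by positivity)

theorem UModerate.mul_null (h₁ : UModerate s w₁) (h₂ : UNull s w₂)
    (n₂ : ∀ φ z, 0 ≤ w₂ φ z) :
    UNull s (fun φ z => w₁ φ z * w₂ φ z) := by
  obtain ⟨N, h₁⟩ := h₁
  obtain ⟨M, γ, hγ, h₂⟩ := h₂
  refine ⟨N + M, γ, hγ, fun q hq φ hφ => ?_⟩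
  obtain ⟨c, hc, h₁⟩ := h₁ φ (A_anti ((Nat.le_add_right _ _).trans hq) hφ)
  obtain ⟨d, hd, h₂⟩ := h₂ q ((Nat.le_add_left _ _).trans hq) φ hφ
  refine ⟨c * d, by positivity, ?_⟩
  filter_upwards [h₁, h₂, eventually_small] with ε h₁ h₂ hε z hz
  have e : ε ^ (γ q - ((N + M : ℕ) : ℝ)) = ε ^ (-(N : ℝ)) * ε ^ (γ q - M) := by
    rw [← Real.rpow_add hε.1]
    congr 1
    push_cast
    ring
  rw [e, mul_mul_mul_comm]
  have := Real.rpow_nonneg hε.1.le (-(N : ℝ))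
  exact mul_le_mul (h₁ z hz) (h₂ z hz) (n₂ _ _) (by positivity)

theorem UModerate.sum {ι : Type} (t : Finset ι) {w : ι → A0 → X → ℝ}
    (h : ∀ i ∈ t, UModerate s (w i)) : UModerate s (fun φ z => ∑ i ∈ t, w i φ z) := by
  classical
  induction t using Finset.induction_on with
  | empty => simpa using uModerate_const (s := s) 0
  | insert a t ha ih =>
    simp_rw [Finset.sum_insert ha]
    exact (h a (by simp)).add (ih fun i hi => h i (by simp [hi]))

theorem UNull.sum {ι : Type} (t : Finset ι) {w : ι → A0 → X → ℝ}
    (h : ∀ i ∈ t, UNull s (w i)) : UNull s (fun φ z => ∑ i ∈ t, w i φ z) := by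
  classical
  induction t using Finset.induction_on with
  | empty => simpa using uNull_zero (s := s)
  | insert a t ha ih =>
    simp_rw [Finset.sum_insert ha]
    exact (h a (by simp)).add (ih fun i hi => h i (by simp [hi]))

end growth

/-! ### Generalized numbers -/

/-- Moderate families of complex numbers. -/
def IsModerate (v : A0 → ℂ) : Prop :=
  ∃ N : ℕ, ∀ φ ∈ A N, ∃ c > 0, ∀ᶠ ε in 𝓝[>] (0 : ℝ), ‖v (scale ε φ)‖ ≤ c * ε ^ (-(N : ℝ))

/-- Negligible families of complex numbers. -/
def IsNull (v : A0 → ℂ) : Prop :=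
  ∃ N : ℕ, ∃ γ : ℕ → ℝ, IsGamma γ ∧ ∀ q ≥ N, ∀ φ ∈ A q, ∃ c > 0,
    ∀ᶠ ε in 𝓝[>] (0 : ℝ), ‖v (scale ε φ)‖ ≤ c * ε ^ (γ q - N)

theorem isModerate_iff {v : A0 → ℂ} :
    IsModerate v ↔ UModerate (univ : Set Unit) (fun φ _ => ‖v φ‖) := by
  simp [IsModerate, UModerate]

theorem isNull_iff {v : A0 → ℂ} :
    IsNull v ↔ UNull (univ : Set Unit) (fun φ _ => ‖v φ‖) := by
  simp [IsNull, UNull]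

/-- The algebra of moderate families of complex numbers. -/
def EMNum : Subalgebra ℂ (A0 → ℂ) where
  carrier := {v | IsModerate v}
  mul_mem' {a b} ha hb := by
    simp only [mem_ofPred_eq, isModerate_iff] at *
    simpa using ha.mul hb (fun _ _ => norm_nonneg _)
  add_mem' {a b} ha hb := by
    simp only [mem_ofPred_eq, isModerate_iff] at *
    exact (ha.add hb).mono fun _ _ _ => norm_add_le _ _
  algebraMap_mem' r := by
    simp only [mem_ofPred_eq, isModerate_iff]
    exact uModerate_const ‖r‖

/-- The ideal of negligible families of complex numbers. -/
def NNum : Ideal EMNum where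
  carrier := {v | IsNull v.1}
  add_mem' {a b} ha hb := by
    simp only [mem_ofPred_eq, isNull_iff] at *
    exact (ha.add hb).mono fun _ _ _ => norm_add_le _ _
  zero_mem' := by
    simp only [mem_ofPred_eq, isNull_iff]
    simpa using uNull_zero (s := (univ : Set Unit))
  smul_mem' a b hb := by
    have ha : IsModerate a.1 := a.2
    simp only [mem_ofPred_eq, isNull_iff, isModerate_iff] at *
    simpa using ha.mul_null hb (fun _ _ => norm_nonneg _)

/-- The ring `ℂ̄` of full generalized complex numbers. -/
abbrev GC : Type := EMNum ⧸ NNum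

/-- The class `cl[(v(φ))_φ]` in `ℂ̄` of a moderate family. -/
def cl (v : EMNum) : GC := Ideal.Quotient.mk NNum v

/-- The subring `ℝ̄` of `ℂ̄`: the classes of real-valued families. -/
def realNumbers : Set GC := {x | ∃ v : EMNum, cl v = x ∧ ∀ φ, (v.1 φ).im = 0}

/-- Association to zero, `x ≈ 0`. -/
def AssocZero (x : GC) : Prop :=
  ∃ v : EMNum, cl v = x ∧ ∃ p : ℕ, ∀ φ ∈ A p,
    Tendsto (fun ε : ℝ => v.1 (scale ε φ)) (𝓝[>] 0) (𝓝 0)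

/-- `i(φ)`, the diameter of the support of `φ`. -/
def suppDiam (φ : A0) : ℝ := Metric.diam (tsupport φ.1)

theorem suppDiam_scale {ε : ℝ} (hε : 0 < ε) (φ : A0) :
    suppDiam (scale ε φ) = ε * suppDiam φ := by
  have h : Function.support (fun x => ε⁻¹ * φ.1 (ε⁻¹ * x)) = ε • Function.support φ.1 := by
    rw [← support_comp_inv_smul₀ hε.ne']
    ext x
    simp [hε.ne']
  simp only [suppDiam, scale, hε, dif_pos, tsupport, h]
  rw [closure_smul₀' hε.ne' (Function.support φ.1), diam_smul₀, Real.norm_of_nonneg hε.le]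

/-- `α̇_r ∈ ℂ̄`, the class of `φ ↦ i(φ)^r`. -/
def alpha (r : ℝ) : GC :=
  cl ⟨fun φ => ((suppDiam φ ^ r : ℝ) : ℂ), by
    obtain ⟨N, hN⟩ := exists_nat_ge (-r)
    refine ⟨N, fun φ _ => ⟨suppDiam φ ^ r + 1, ?_, ?_⟩⟩
    · have := Real.rpow_nonneg (Metric.diam_nonneg (s := tsupport φ.1)) r
      simp only [suppDiam]
      positivity
    · filter_upwards [eventually_small] with ε hε
      have h0 : 0 ≤ suppDiam φ := Metric.diam_nonneg
      have h1 := Real.rpow_nonneg h0 r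
      rw [suppDiam_scale hε.1, Complex.norm_real, Real.mul_rpow hε.1.le h0, Real.norm_of_nonneg
        (mul_nonneg (Real.rpow_nonneg hε.1.le _) h1), mul_comm]
      have e : ε ^ r ≤ ε ^ (-(N : ℝ)) := rpow_le_of_small hε (by linarith)
      exact mul_le_mul (by linarith) e (Real.rpow_nonneg hε.1.le _) (by linarith)⟩

/-- The valuation `V(x) = sup {r | α̇_{-r} x ≈ 0}`. -/
def val (x : GC) : EReal := sSup ((fun r : ℝ => (r : EReal)) '' {r | AssocZero (alpha (-r) * x)})

/-- The sharp norm `‖x‖ = e^{-V(x)}` of a generalized number, `‖0‖ = e^{-∞} = 0`. -/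
def gnorm (x : GC) : ℝ := (EReal.exp (-val x)).toReal

/-- The open ball `B_r(z₀)` of the sharp topology. -/
def gball (z₀ : GC) (r : ℝ) : Set GC := {z | gnorm (z - z₀) < r}

/-! ### Generalized functions -/

section functions

variable (Ω : TopologicalSpace.Opens ℂ)

/-- Moderate families of smooth functions on `Ω`. The values outside `Ω` are irrelevant. The
derivatives are those over `ℝ` (so `Ω ⊆ ℂ = ℝ²`), and the norm of the `n`-th Fréchet derivative
controls, and is controlled by, the partial derivatives of order `n`. -/
def IsModerateFun (u : A0 → ℂ → ℂ) : Prop :=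
  (∀ φ, ContDiffOn ℝ ∞ (u φ) Ω) ∧
    ∀ K : Set ℂ, K ⊆ Ω → IsCompact K → ∀ n : ℕ,
      UModerate K (fun φ z => ‖iteratedFDeriv ℝ n (u φ) z‖)

/-- Negligible families of functions on `Ω`. -/
def IsNullFun (u : A0 → ℂ → ℂ) : Prop :=
  ∀ K : Set ℂ, K ⊆ Ω → IsCompact K → ∀ n : ℕ,
    UNull K (fun φ z => ‖iteratedFDeriv ℝ n (u φ) z‖)

variable {Ω}

theorem contDiffAt_of_mem {g : ℂ → ℂ} (h : ContDiffOn ℝ ∞ g Ω) {z : ℂ} (hz : z ∈ Ω) (n : ℕ) :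
    ContDiffAt ℝ n g z :=
  (h.contDiffAt (Ω.isOpen.mem_nhds hz)).of_le (by exact_mod_cast le_top)

theorem norm_iteratedFDeriv_add_le {g h : ℂ → ℂ} (hg : ContDiffOn ℝ ∞ g Ω)
    (hh : ContDiffOn ℝ ∞ h Ω) {z : ℂ} (hz : z ∈ Ω) (n : ℕ) :
    ‖iteratedFDeriv ℝ n (g + h) z‖ ≤ ‖iteratedFDeriv ℝ n g z‖ + ‖iteratedFDeriv ℝ n h z‖ := by
  rw [iteratedFDeriv_add_apply (contDiffAt_of_mem hg hz n) (contDiffAt_of_mem hh hz n)]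
  exact norm_add_le _ _

theorem norm_iteratedFDeriv_mul_le' {g h : ℂ → ℂ} (hg : ContDiffOn ℝ ∞ g Ω)
    (hh : ContDiffOn ℝ ∞ h Ω) {z : ℂ} (hz : z ∈ Ω) (n : ℕ) :
    ‖iteratedFDeriv ℝ n (g * h) z‖ ≤ ∑ i ∈ Finset.range (n + 1),
      (n.choose i : ℝ) * ‖iteratedFDeriv ℝ i g z‖ * ‖iteratedFDeriv ℝ (n - i) h z‖ := by
  have := norm_iteratedFDerivWithin_mul_le (n := n) hg hh Ω.isOpen.uniqueDiffOn hz
    (by exact_mod_cast le_top)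
  simp only [iteratedFDerivWithin_of_isOpen _ Ω.isOpen hz] at this
  exact this

variable (Ω) in
/-- The algebra `ℰ_M(Ω)`. -/
def EM : Subalgebra ℂ (A0 → ℂ → ℂ) where
  carrier := {u | IsModerateFun Ω u}
  mul_mem' {a b} ha hb := by
    refine ⟨fun φ => (ha.1 φ).mul (hb.1 φ), fun K hK hK' n => ?_⟩
    refine UModerate.mono (UModerate.sum (Finset.range (n + 1)) fun i _ => ?_)
      fun φ z hz => norm_iteratedFDeriv_mul_le' (ha.1 φ) (hb.1 φ) (hK hz) n
    exact ((uModerate_const _).mul (ha.2 K hK hK' i)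
      fun _ _ => norm_nonneg _).mul (hb.2 K hK hK' (n - i))
      fun _ _ => norm_nonneg _
  add_mem' {a b} ha hb :=
    ⟨fun φ => (ha.1 φ).add (hb.1 φ), fun K hK hK' n =>
      ((ha.2 K hK hK' n).add (hb.2 K hK hK' n)).mono fun φ _ hz =>
        norm_iteratedFDeriv_add_le (ha.1 φ) (hb.1 φ) (hK hz) n⟩
  algebraMap_mem' r := by
    refine ⟨fun φ => contDiffOn_const, fun K hK hK' n => ?_⟩
    have : ∀ φ z, ‖iteratedFDeriv ℝ n (algebraMap ℂ (A0 → ℂ → ℂ) r φ) z‖ ≤ ‖r‖ := by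
      intro φ z
      have : algebraMap ℂ (A0 → ℂ → ℂ) r φ = fun _ => r := rfl
      rw [this]
      rcases n with _ | n
      · simp
      · rw [iteratedFDeriv_succ_const]
        simp
    exact (uModerate_const ‖r‖).mono fun φ z _ => this φ z

variable (Ω) in
/-- The ideal `𝒩(Ω)` of `ℰ_M(Ω)`. -/
def NF : Ideal (EM Ω) where
  carrier := {u | IsNullFun Ω u.1}
  add_mem' {a b} ha hb := fun K hK hK' n =>
    ((ha K hK hK' n).add (hb K hK hK' n)).mono fun φ _ hz =>
        norm_iteratedFDeriv_add_le (a.2.1 φ) (b.2.1 φ) (hK hz) n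
  zero_mem' := fun K hK hK' n => by
    refine uNull_zero.mono fun φ z _ => ?_
    have : (((0 : EM Ω) : A0 → ℂ → ℂ) φ) = fun _ => 0 := rfl
    rw [this, iteratedFDeriv_fun_zero]
    simp
  smul_mem' a b hb := by
    intro K hK hK' n
    refine UNull.mono (UNull.sum (Finset.range (n + 1)) fun i _ => ?_)
      fun φ z hz => norm_iteratedFDeriv_mul_le' (a.2.1 φ) (b.2.1 φ) (hK hz) n
    exact ((uModerate_const _).mul (a.2.2 K hK hK' i)
      fun _ _ => norm_nonneg _).mul_null (hb K hK hK' (n - i))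
      fun _ _ => norm_nonneg _

variable (Ω) in
/-- The algebra `𝒢(Ω)` of full generalized functions on `Ω`. -/
abbrev G : Type := EM Ω ⧸ NF Ω

/-- The class in `𝒢(Ω)` of a moderate family of functions. -/
def clF (u : EM Ω) : G Ω := Ideal.Quotient.mk (NF Ω) u

/-- `∂g/∂z = ½ (∂_x g - i ∂_y g)`. -/
def dz (g : ℂ → ℂ) (z : ℂ) : ℂ :=
  (fderiv ℝ g z 1 - Complex.I * fderiv ℝ g z Complex.I) / 2

/-- `∂g/∂z̄ = ½ (∂_x g + i ∂_y g)`. -/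
def dzbar (g : ℂ → ℂ) (z : ℂ) : ℂ :=
  (fderiv ℝ g z 1 + Complex.I * fderiv ℝ g z Complex.I) / 2

/-- The linear map sending `fderiv ℝ g z` to `dzbar g z`. -/
def dzbarL : (ℂ →L[ℝ] ℂ) →L[ℝ] ℂ :=
  (2⁻¹ : ℝ) • (ContinuousLinearMap.apply ℝ ℂ (1 : ℂ) +
    (ContinuousLinearMap.mul ℝ ℂ Complex.I).comp (ContinuousLinearMap.apply ℝ ℂ Complex.I))

theorem dzbar_eq (g : ℂ → ℂ) : dzbar g = dzbarL ∘ fderiv ℝ g := by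
  ext z
  simp [dzbar, dzbarL]
  ring

theorem contDiffOn_fderiv_of {g : ℂ → ℂ} (hg : ContDiffOn ℝ ∞ g Ω) :
    ContDiffOn ℝ ∞ (fderiv ℝ g) Ω :=
  hg.fderiv_of_isOpen Ω.isOpen (by simp)

theorem norm_iteratedFDeriv_dzbar_le {g : ℂ → ℂ} (hg : ContDiffOn ℝ ∞ g Ω) {z : ℂ} (hz : z ∈ Ω)
    (n : ℕ) : ‖iteratedFDeriv ℝ n (dzbar g) z‖ ≤ ‖dzbarL‖ * ‖iteratedFDeriv ℝ (n + 1) g z‖ := by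
  rw [dzbar_eq, ← norm_iteratedFDeriv_fderiv]
  refine dzbarL.norm_iteratedFDeriv_comp_left (N := n) ?_ le_rfl
  exact ((contDiffOn_fderiv_of hg).contDiffAt (Ω.isOpen.mem_nhds hz)).of_le
    (by exact_mod_cast le_top)

/-- `∂̄` on representatives. -/
def dzbarEM (u : EM Ω) : EM Ω :=
  ⟨fun φ => dzbar (u.1 φ), fun φ => by
      change ContDiffOn ℝ ∞ (dzbar (u.1 φ)) Ω
      rw [dzbar_eq]
      exact dzbarL.contDiff.comp_contDiffOn (contDiffOn_fderiv_of (u.2.1 φ)),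
    fun K hK hK' n => ((uModerate_const ‖dzbarL‖).mul (u.2.2 K hK hK' (n + 1))
      fun _ _ => norm_nonneg _).mono
        fun φ _ hz => norm_iteratedFDeriv_dzbar_le (u.2.1 φ) (hK hz) n⟩

/-- `∂̄ : 𝒢(Ω) → 𝒢(Ω)`. -/
def dzbarG (f : G Ω) : G Ω :=
  Quotient.liftOn' f (fun u => clF (dzbarEM u)) fun u v h => by
    have h : IsNullFun Ω (u - v : EM Ω).1 := (Submodule.quotientRel_def _).1 h
    refine Ideal.Quotient.eq.2 fun K hK hK' n => ?_
    refine (((uModerate_const ‖dzbarL‖).mul_null (h K hK hK' (n + 1))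
      fun _ _ => norm_nonneg _)).mono fun φ z hz => ?_
    refine le_trans (le_of_eq ?_) (norm_iteratedFDeriv_dzbar_le ((u - v).2.1 φ) (hK hz) n)
    refine congrArg _ (Filter.EventuallyEq.eq_of_nhds (Filter.EventuallyEq.iteratedFDeriv ℝ ?_ n))
    filter_upwards [Ω.isOpen.mem_nhds (hK hz)] with y hy
    have hu := (contDiffAt_of_mem (u.2.1 φ) hy 1).differentiableAt (by simp)
    have hv := (contDiffAt_of_mem (v.2.1 φ) hy 1).differentiableAt (by simp)
    have : fderiv ℝ ((u - v : EM Ω).1 φ) y = fderiv ℝ (u.1 φ) y - fderiv ℝ (v.1 φ) y :=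
      fderiv_sub hu hv
    rw [dzbar_eq, Function.comp_apply, this, map_sub]
    change dzbar _ y - dzbar _ y = _
    simp only [dzbar_eq, Function.comp_apply]

/-- `f ∈ ℋ𝒢(Ω)`. -/
def IsHolomorphic (f : G Ω) : Prop := dzbarG f = 0

/-! ### Compactly supported points and point values -/

variable (Ω) in
/-- The family `x` takes its values in `Ω`, and in a fixed compact subset of `Ω` along `φ_ε`, for
`ε` small. -/
def IsCompactlySupported (x : A0 → ℂ) : Prop :=
  (∀ φ, x φ ∈ Ω) ∧ ∃ K : Set ℂ, K ⊆ Ω ∧ IsCompact K ∧ ∃ p : ℕ, ∀ φ ∈ A p,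
    ∀ᶠ ε in 𝓝[>] (0 : ℝ), x (scale ε φ) ∈ K

variable (Ω) in
/-- The set `Ω̃_c` of compactly supported points, as a subset of `ℂ̄`. -/
def compactPoints : Set GC := {x | ∃ v : EMNum, cl v = x ∧ IsCompactlySupported Ω v.1}

/-- The family `(u_φ(x_φ))_φ`. -/
def pointEval (u : EM Ω) (x : EMNum) (hx : IsCompactlySupported Ω x.1) : EMNum :=
  ⟨fun φ => u.1 φ (x.1 φ), by
    obtain ⟨-, K, hK, hK', p, hp⟩ := hx
    obtain ⟨N, hN⟩ := u.2.2 K hK hK' 0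
    refine ⟨max N p, fun φ hφ => ?_⟩
    obtain ⟨c, hc, h⟩ := hN φ (A_anti (le_max_left _ _) hφ)
    refine ⟨c, hc, ?_⟩
    filter_upwards [h, hp φ (A_anti (le_max_right _ _) hφ), eventually_small] with ε h hp hε
    have h := h _ hp
    rw [norm_iteratedFDeriv_zero] at h
    refine h.trans ?_
    have e : ε ^ (-(N : ℝ)) ≤ ε ^ (-((max N p : ℕ) : ℝ)) := rpow_le_of_small hε (by simp)
    gcongr⟩

theorem cl_pointEval_congr_left {u v : EM Ω} (h : u - v ∈ NF Ω) (x : EMNum)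
    (hx : IsCompactlySupported Ω x.1) : cl (pointEval u x hx) = cl (pointEval v x hx) := by
  refine Ideal.Quotient.eq.2 ?_
  obtain ⟨-, K, hK, hK', p, hp⟩ := hx
  obtain ⟨N, γ, hγ, hN⟩ := h K hK hK' 0
  refine ⟨max N p, γ, hγ, fun q hq φ hφ => ?_⟩
  obtain ⟨c, hc, h⟩ := hN q ((le_max_left _ _).trans hq) φ hφ
  refine ⟨c, hc, ?_⟩
  filter_upwards [h, hp φ (A_anti ((le_max_right _ _).trans hq) hφ), eventually_small]
    with ε h hp hε
  have h := h _ hp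
  rw [norm_iteratedFDeriv_zero] at h
  refine h.trans ?_
  have e : ε ^ (γ q - (N : ℝ)) ≤ ε ^ (γ q - ((max N p : ℕ) : ℝ)) :=
    rpow_le_of_small hε (sub_le_sub_left (by simp) _)
  gcongr

/-- The map `κ(f) : Ω̃_c → ℂ̄`, `κ(f)(cl[x_φ]) = cl[u_φ(x_φ)]` where `u` represents `f`. It is
extended by `0` outside `Ω̃_c`, where it is never used. -/
def kappa (f : G Ω) (x : GC) : GC :=
  open Classical in
  if hx : x ∈ compactPoints Ω then
    Quotient.liftOn' f (fun u => cl (pointEval u hx.choose hx.choose_spec.2)) fun _ _ h =>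
      cl_pointEval_congr_left ((Submodule.quotientRel_def _).1 h) _ _
  else 0

theorem cl_pointEval_congr_right (u : EM Ω) {x y : EMNum} (h : cl x = cl y)
    (hx : IsCompactlySupported Ω x.1) (hy : IsCompactlySupported Ω y.1) :
    cl (pointEval u x hx) = cl (pointEval u y hy) := by
  refine Ideal.Quotient.eq.2 ?_
  obtain ⟨-, K, hK, hK', p, hp⟩ := hx
  obtain ⟨N, γ, hγ, hN⟩ := Ideal.Quotient.eq.1 h
  obtain ⟨δ, hδ, hδK⟩ := hK'.exists_cthickening_subset_open Ω.isOpen hK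
  obtain ⟨M, hM⟩ := u.2.2 _ hδK hK'.cthickening 1
  obtain ⟨n₀, hn₀⟩ := eventually_atTop.1 (tendsto_atTop.1 hγ.2.2 (N + 1))
  refine ⟨N + M + p + n₀, γ, hγ, fun q hq φ hφ => ?_⟩
  obtain ⟨c, hc, h₁⟩ := hN q (by omega) φ hφ
  obtain ⟨d, hd, h₂⟩ := hM φ (A_anti (by omega) hφ)
  refine ⟨d * c, by positivity, ?_⟩
  have hsmall : Tendsto (fun ε : ℝ => c * ε) (𝓝[>] 0) (𝓝 0) := by
    have : Tendsto (fun ε : ℝ => c * ε) (𝓝 0) (𝓝 (c * 0)) := tendsto_id.const_mul c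
    rw [mul_zero] at this
    exact this.mono_left nhdsWithin_le_nhds
  filter_upwards [h₁, h₂, hp φ (A_anti (by omega) hφ), eventually_small,
    hsmall.eventually (gt_mem_nhds hδ)] with ε h₁ h₂ hp hε hεδ
  change ‖x.1 (scale ε φ) - y.1 (scale ε φ)‖ ≤ _ at h₁
  have e₁ : ε ^ (γ q - N) ≤ ε := by
    have := rpow_le_of_small hε (a := γ q - N) (b := 1) (by have := hn₀ q (by omega); linarith)
    simpa using this
  have hdist : ‖x.1 (scale ε φ) - y.1 (scale ε φ)‖ ≤ δ :=
    h₁.trans ((mul_le_mul_of_nonneg_left e₁ hc.le).trans hεδ.le)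
  have hball : Metric.closedBall (x.1 (scale ε φ)) δ ⊆ Metric.cthickening δ K :=
    Metric.closedBall_subset_cthickening hp δ
  have key := (convex_closedBall (x.1 (scale ε φ)) δ).norm_image_sub_le_of_norm_fderiv_le
    (𝕜 := ℝ) (f := u.1 (scale ε φ)) (C := d * ε ^ (-(M : ℝ)))
    (fun z hz => (contDiffAt_of_mem (u.2.1 _) (hδK (hball hz)) 1).differentiableAt (by simp))
    (fun z hz => by
      have := h₂ z (hball hz)
      rwa [norm_iteratedFDeriv_one] at this)
    (x := y.1 (scale ε φ)) (y := x.1 (scale ε φ))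
    (by rw [mem_closedBall_iff_norm, norm_sub_rev]; exact hdist)
    (Metric.mem_closedBall_self hδ.le)
  change ‖u.1 (scale ε φ) (x.1 (scale ε φ)) - u.1 (scale ε φ) (y.1 (scale ε φ))‖ ≤ _
  refine key.trans ?_
  have e₂ : ε ^ (-(M : ℝ)) * ε ^ (γ q - N) ≤ ε ^ (γ q - ((N + M + p + n₀ : ℕ) : ℝ)) := by
    rw [← Real.rpow_add hε.1]
    refine rpow_le_of_small hε ?_
    have h1 : (0 : ℝ) ≤ p := p.cast_nonneg
    have h2 : (0 : ℝ) ≤ n₀ := n₀.cast_nonneg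
    push_cast
    linarith
  have h0 := Real.rpow_nonneg hε.1.le (-(M : ℝ))
  calc d * ε ^ (-(M : ℝ)) * ‖x.1 (scale ε φ) - y.1 (scale ε φ)‖
      ≤ d * ε ^ (-(M : ℝ)) * (c * ε ^ (γ q - N)) := by gcongr
    _ = d * c * (ε ^ (-(M : ℝ)) * ε ^ (γ q - N)) := by ring
    _ ≤ _ := by gcongr

/-- The value `κ(f)(x)` does not depend on the representatives of `f` and `x`. -/
theorem kappa_cl (u : EM Ω) (x : EMNum) (hx : IsCompactlySupported Ω x.1) :
    kappa (clF u) (cl x) = cl (pointEval u x hx) := by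
  have h : cl x ∈ compactPoints Ω := ⟨x, rfl, hx⟩
  rw [kappa, dif_pos h]
  exact cl_pointEval_congr_right u h.choose_spec.1 h.choose_spec.2 hx

/-- Sub-linear generalized functions. The derivatives `f̂^{(n)}` are the derivatives `∂ⁿ/∂zⁿ`. -/
def IsSubLinear (f : G Ω) : Prop :=
  ∃ u : EM Ω, clF u = f ∧ ∀ x ∈ compactPoints Ω,
    ∃ v : EMNum, cl v = x ∧ (∀ φ, v.1 φ ∈ Ω) ∧
      ∃ (k : ℝ) (p : ℕ → ℝ), Tendsto (fun n : ℕ => p n + k * n) atTop atTop ∧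
        ∀ n : ℕ, ∃ q : ℕ, ∀ φ ∈ A q, ∃ c > 0, ∀ᶠ ε in 𝓝[>] (0 : ℝ),
          ‖dz^[n] (u.1 (scale ε φ)) (v.1 (scale ε φ))‖ ≤ c * ε ^ p n

end functions

/-! ### Differential calculus over `ℂ̄`

Functions are defined on a subset `U` of `ℂ̄`; the values outside `U` are not used. For `h ≠ 0`, the
quotient by `β̇_{‖h‖} = α̇_{-log ‖h‖}` is the product with `α̇_{log ‖h‖}`. -/

/-- `F : U → ℂ̄` is differentiable at `z₀` with derivative `d`. -/
def HasGDeriv (U : Set GC) (F : GC → GC) (z₀ d : GC) : Prop :=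
  ∀ ε > 0, ∃ δ > 0, ∀ z ∈ U, 0 < gnorm (z - z₀) → gnorm (z - z₀) < δ →
    gnorm (alpha (Real.log (gnorm (z - z₀))) * (F z - F z₀ - d * (z - z₀))) < ε

/-- `D n`, `n = 0, 1, 2, …`, are the successive derivatives of `F : U → ℂ̄`. -/
def IsDerivSeq (U : Set GC) (F : GC → GC) (D : ℕ → GC → GC) : Prop :=
  (∀ z ∈ U, D 0 z = F z) ∧ ∀ n, ∀ z ∈ U, HasGDeriv U (D n) z (D (n + 1) z)

/-- For `ℂ̄ = ℝ̄ + iℝ̄`, the partial derivative of `F : U → ℂ̄` at `z₀` in the direction `e` (`e = 1`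
for `∂_x`, `e = i` for `∂_y`) is `a`; the increment `h` is in `ℝ̄`. -/
def HasGPartial (U : Set GC) (F : GC → GC) (e z₀ a : GC) : Prop :=
  ∀ ε > 0, ∃ δ > 0, ∀ h ∈ realNumbers, z₀ + h * e ∈ U → 0 < gnorm h → gnorm h < δ →
    gnorm (alpha (Real.log (gnorm h)) * (F (z₀ + h * e) - F z₀ - a * h)) < ε

/-- `∂F/∂z̄ (z₀) = ½ (∂_x F (z₀) + i ∂_y F (z₀))` exists and equals `b`. -/
def HasGDzbar (U : Set GC) (F : GC → GC) (z₀ b : GC) : Prop :=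
  ∃ a₁ a₂ : GC, HasGPartial U F 1 z₀ a₁ ∧ HasGPartial U F (algebraMap ℂ GC Complex.I) z₀ a₂ ∧
    b = algebraMap ℂ GC (1 / 2) * (a₁ + algebraMap ℂ GC Complex.I * a₂)

/-- The partial sum `∑_{n < m} a_n (z - z₀)^n`. -/
def partialSum (a : ℕ → GC) (z₀ z : GC) (m : ℕ) : GC :=
  ∑ n ∈ Finset.range m, a n * (z - z₀) ^ n

/-- `F : U → ℂ̄` is analytic: near each point of `U` it is the sum of a power series which converges
for the sharp topology. -/
def IsAnalytic (U : Set GC) (F : GC → GC) : Prop :=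
  ∀ z₀ ∈ U, ∃ r > 0, gball z₀ r ⊆ U ∧ ∃ a : ℕ → GC, ∀ z ∈ gball z₀ r,
    Tendsto (fun m => gnorm (partialSum a z₀ z m - F z)) atTop (𝓝 0)

/-- The power series `∑ a_n (z - z₀)^n` converges to `F`, uniformly on `B`. -/
def ConvergesUniformlyTo (B : Set GC) (a : ℕ → GC) (z₀ : GC) (F : GC → GC) : Prop :=
  ∀ ε > 0, ∃ M : ℕ, ∀ m ≥ M, ∀ z ∈ B, gnorm (partialSum a z₀ z m - F z) < ε

end Colombeau

end

/-!
Let `f` be the class of `u`. Along the mollifiers `φ_ε` a generalized number is a function of `ε`,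
and its sharp norm is at most `e^{-r}` as soon as it is `O(ε^r)`; conversely a norm smaller than
`e^{-r}` gives `O(ε^r)` (`gnorm_le_of_hasOrder`, `hasOrder_of_gnorm_lt`). The sharp norm is
ultrametric and submultiplicative, and multiplication by `α̇_r` scales it by `e^{-r}`.

*Analytic implies sub-linear.* Let `κ(u) = ∑ a_n (z - z₀)^n` near `z₀`. At a point `z` near `z₀`,
compare the increment of the series with the first order Taylor formula for `u`, for the increments
`c α̇_ρ` with `c = 1, i`. Both remainders are of order `2ρ`, so that, as `ρ → ∞`, the differentiated
series converges to `κ(∂u)`, and `κ(∂̄u)` drops out (`HasSeries.kappa_dzEM`). By iteration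
`κ(∂^n u)(z₀) = n! a_n` up to elements of norm zero (`HasSeries.gnorm_kappa_iterate_le`). Since the
terms of the series at `z = z₀ + α̇_ρ` tend to zero, `‖a_n‖ e^{-ρ n} → 0`, which is the growth
condition defining sub-linearity, with `k = ρ`.

*Holomorphic implies analytic.* Now `∂̄u` is negligible. Averaging over circles and integrating by
parts shows that `∂g(x)` is controlled by `sup |g|` on a disc, up to multiples of `∂̄g` and `∂̄∂g`
(`norm_dz_le`). Consequently all the derivatives `∂^n u` on a compact set grow at most like
`ε^{-N}`, with the same `N` for all `n` (`IsHolFamily.uHasOrder_iterate`). In Taylor's formula with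
respect to `∂/∂z` the terms with `∂̄` are negligible, and for `‖z - z₀‖ < e⁻¹` the remainder of order
`m` has norm at most `e^{N - m}`: the Taylor series converges uniformly on the ball of radius `e⁻¹`
(`IsHolFamily.convergesUniformlyTo`). The first order formula shows that `κ(∂u)` is the derivative
of `κ(u)` (`IsHolFamily.hasGDeriv`); it applies to all the `∂^n u`, and complex differentiability
gives the Cauchy–Riemann equation.
-/

namespace Colombeau

/-! ### Orders of growth and the sharp norm -/

/-- The family `v` is `O(ε^r)` along `φ_ε`, for all `φ` with sufficiently many vanishing moments. -/
def HasOrder (r : ℝ) (v : A0 → ℂ) : Prop :=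
  ∃ q : ℕ, ∀ φ ∈ A q, ∃ c > 0, ∀ᶠ ε in 𝓝[>] (0 : ℝ), ‖v (scale ε φ)‖ ≤ c * ε ^ r

theorem suppDiam_pos (φ : A0) : 0 < suppDiam φ := by
  obtain ⟨φ, h1, h2, -, -, h5⟩ := φ
  obtain ⟨x, hx⟩ : ∃ x, φ x ≠ 0 := by
    by_contra! h
    simp [h] at h5
  have hU : IsOpen (Function.support φ) := h1.continuous.isOpen_support
  obtain ⟨δ, hδ, hb⟩ := Metric.isOpen_iff.1 hU x hx
  have m1 : x ∈ tsupport φ := subset_closure hx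
  have m2 : x + δ / 2 ∈ tsupport φ :=
    subset_closure (hb (by simp [abs_of_pos hδ, hδ]))
  have := Metric.dist_le_diam_of_mem h2.isCompact.isBounded m1 m2
  rw [Real.dist_eq, sub_add_cancel_left, abs_neg, abs_of_pos (by positivity)] at this
  exact lt_of_lt_of_le (by positivity) this

section order

variable {r s : ℝ} {v w : A0 → ℂ}

theorem HasOrder.weaken (h : HasOrder r v) (hs : s ≤ r) : HasOrder s v := by
  obtain ⟨q, h⟩ := h
  refine ⟨q, fun φ hφ => ?_⟩
  obtain ⟨c, hc, h⟩ := h φ hφ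
  refine ⟨c, hc, ?_⟩
  filter_upwards [h, eventually_small] with ε h hε
  exact h.trans (by have := rpow_le_of_small hε hs; gcongr)

theorem HasOrder.add (h₁ : HasOrder r v) (h₂ : HasOrder r w) : HasOrder r (v + w) := by
  obtain ⟨q₁, h₁⟩ := h₁
  obtain ⟨q₂, h₂⟩ := h₂
  refine ⟨max q₁ q₂, fun φ hφ => ?_⟩
  obtain ⟨c, hc, h₁⟩ := h₁ φ (A_anti (le_max_left _ _) hφ)
  obtain ⟨d, hd, h₂⟩ := h₂ φ (A_anti (le_max_right _ _) hφ)
  refine ⟨c + d, by positivity, ?_⟩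
  filter_upwards [h₁, h₂] with ε h₁ h₂
  rw [add_mul]
  exact (norm_add_le _ _).trans (add_le_add h₁ h₂)

theorem HasOrder.neg (h : HasOrder r v) : HasOrder r (-v) := by
  simpa [HasOrder] using h

theorem HasOrder.sub (h₁ : HasOrder r v) (h₂ : HasOrder r w) : HasOrder r (v - w) := by
  rw [sub_eq_add_neg]
  exact h₁.add h₂.neg

theorem HasOrder.mul (h₁ : HasOrder r v) (h₂ : HasOrder s w) : HasOrder (r + s) (v * w) := by
  obtain ⟨q₁, h₁⟩ := h₁
  obtain ⟨q₂, h₂⟩ := h₂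
  refine ⟨max q₁ q₂, fun φ hφ => ?_⟩
  obtain ⟨c, hc, h₁⟩ := h₁ φ (A_anti (le_max_left _ _) hφ)
  obtain ⟨d, hd, h₂⟩ := h₂ φ (A_anti (le_max_right _ _) hφ)
  refine ⟨c * d, by positivity, ?_⟩
  filter_upwards [h₁, h₂, eventually_small] with ε h₁ h₂ hε
  rw [Real.rpow_add hε.1, mul_mul_mul_comm, Pi.mul_apply, norm_mul]
  have := Real.rpow_nonneg hε.1.le r
  gcongr

theorem hasOrder_const (c : ℂ) : HasOrder 0 (fun _ => c) :=
  ⟨0, fun _ _ => ⟨‖c‖ + 1, by positivity, by filter_upwards with ε; simp⟩⟩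

theorem IsNull.hasOrder (h : IsNull v) (r : ℝ) : HasOrder r v := by
  obtain ⟨N, γ, hγ, h⟩ := h
  obtain ⟨n₀, hn₀⟩ := eventually_atTop.1 (tendsto_atTop.1 hγ.2.2 (N + r))
  refine ⟨max N n₀, fun φ hφ => ?_⟩
  obtain ⟨c, hc, h⟩ := h (max N n₀) (le_max_left _ _) φ hφ
  refine ⟨c, hc, ?_⟩
  filter_upwards [h, eventually_small] with ε h hε
  have := rpow_le_of_small hε (a := γ (max N n₀) - N) (b := r)
    (by have := hn₀ (max N n₀) (le_max_right _ _); linarith)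
  exact h.trans (by gcongr)

theorem HasOrder.isModerate (h : HasOrder r v) : IsModerate v := by
  obtain ⟨q, h⟩ := h
  obtain ⟨n, hn⟩ := exists_nat_ge (-r)
  refine ⟨max q n, fun φ hφ => ?_⟩
  obtain ⟨c, hc, h⟩ := h φ (A_anti (le_max_left _ _) hφ)
  refine ⟨c, hc, ?_⟩
  filter_upwards [h, eventually_small] with ε h hε
  have : ε ^ r ≤ ε ^ (-((max q n : ℕ) : ℝ)) := by
    refine rpow_le_of_small hε ?_
    have : (n : ℝ) ≤ ((max q n : ℕ) : ℝ) := by simp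
    linarith
  exact h.trans (by gcongr)

theorem hasOrder_zero_of_tendsto {p : ℕ}
    (h : ∀ φ ∈ A p, Tendsto (fun ε : ℝ => v (scale ε φ)) (𝓝[>] 0) (𝓝 0)) : HasOrder 0 v := by
  refine ⟨p, fun φ hφ => ⟨1, one_pos, ?_⟩⟩
  have := (h φ hφ).norm
  rw [norm_zero] at this
  filter_upwards [this.eventually (gt_mem_nhds one_pos)] with ε hε
  simpa using hε.le

end order

theorem IsModerate.hasOrder {v : A0 → ℂ} (h : IsModerate v) : ∃ r, HasOrder r v :=
  h.imp' (fun N : ℕ => -(N : ℝ)) fun N h => ⟨N, h⟩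

theorem cl_eq_iff {v w : EMNum} : cl v = cl w ↔ IsNull (v.1 - w.1) :=
  Ideal.Quotient.eq

theorem cl_surjective : Function.Surjective cl := Ideal.Quotient.mk_surjective

theorem HasOrder.congr {r : ℝ} {v w : EMNum} (h : HasOrder r v.1) (e : cl v = cl w) :
    HasOrder r w.1 := by
  have := h.sub ((cl_eq_iff.1 e).hasOrder r)
  rwa [sub_sub_cancel] at this

/-- Families which agree along `φ_ε` for small `ε` have the same class. -/
theorem cl_eq_of_eventuallyEq {v w : EMNum} (q : ℕ)
    (h : ∀ φ ∈ A q, ∀ᶠ ε in 𝓝[>] (0 : ℝ), v.1 (scale ε φ) = w.1 (scale ε φ)) : cl v = cl w := by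
  refine cl_eq_iff.2 ⟨q, _, isGamma_id, fun p hp φ hφ => ⟨1, one_pos, ?_⟩⟩
  filter_upwards [h φ (A_anti hp hφ), eventually_small] with ε h hε
  have := Real.rpow_nonneg hε.1.le ((p : ℝ) - q)
  simpa [h] using this

/-- The family `φ ↦ i(φ)^r` representing `α̇_r`. -/
noncomputable def alphaRep (r : ℝ) : A0 → ℂ := fun φ => ((suppDiam φ ^ r : ℝ) : ℂ)

theorem hasOrder_alphaRep (r : ℝ) : HasOrder r (alphaRep r) := by
  refine ⟨0, fun φ _ => ⟨suppDiam φ ^ r, Real.rpow_pos_of_pos (suppDiam_pos φ) r, ?_⟩⟩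
  filter_upwards [eventually_small] with ε hε
  have h0 := (suppDiam_pos φ).le
  rw [alphaRep, suppDiam_scale hε.1, Complex.norm_real, Real.mul_rpow hε.1.le h0,
    Real.norm_of_nonneg (mul_nonneg (Real.rpow_nonneg hε.1.le _) (Real.rpow_nonneg h0 _)), mul_comm]

/-- `alphaRep r` as a moderate family. -/
noncomputable def alphaEM (r : ℝ) : EMNum := ⟨alphaRep r, (hasOrder_alphaRep r).isModerate⟩

theorem alphaRep_add (r s : ℝ) : alphaRep (r + s) = alphaRep r * alphaRep s := by
  ext φ
  simp [alphaRep, Real.rpow_add (suppDiam_pos φ)]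

theorem alphaRep_zero : alphaRep 0 = 1 := by
  ext φ
  simp [alphaRep]

theorem alpha_add (r s : ℝ) : alpha (r + s) = alpha r * alpha s :=
  congrArg cl (Subtype.ext (alphaRep_add r s) : alphaEM (r + s) = alphaEM r * alphaEM s)

theorem alpha_zero : alpha 0 = 1 :=
  congrArg cl (Subtype.ext alphaRep_zero : alphaEM 0 = 1)

theorem alpha_neg_mul (r : ℝ) (x : GC) : alpha (-r) * (alpha r * x) = x := by
  rw [← mul_assoc, ← alpha_add, neg_add_cancel, alpha_zero, one_mul]

theorem le_val_of_hasOrder {r : ℝ} {v : EMNum} (h : HasOrder r v.1) : (r : EReal) ≤ val (cl v) := by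
  refine le_of_forall_lt fun a ha => ?_
  obtain ⟨s, hs, hs'⟩ := EReal.lt_iff_exists_real_btwn.1 ha
  refine hs.trans_le (le_sSup ⟨s, ?_, rfl⟩)
  refine ⟨alphaEM (-s) * v, rfl, ?_⟩
  have hsr : s < r := by exact_mod_cast hs'
  obtain ⟨q, h⟩ := (hasOrder_alphaRep (-s)).mul h
  refine ⟨q, fun φ hφ => ?_⟩
  obtain ⟨c, -, h⟩ := h φ hφ
  refine squeeze_zero_norm' h ?_
  have h1 : Tendsto (fun ε : ℝ => ε ^ (-s + r)) (𝓝 0) (𝓝 (0 ^ (-s + r))) :=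
    (Real.continuousAt_rpow_const 0 (-s + r) (Or.inr (by linarith))).tendsto
  rw [Real.zero_rpow (by linarith)] at h1
  have h2 := (h1.mono_left (nhdsWithin_le_nhds (s := Ioi 0))).const_mul c
  rwa [mul_zero] at h2

theorem hasOrder_of_lt_val {r : ℝ} {v : EMNum} (h : (r : EReal) < val (cl v)) : HasOrder r v.1 := by
  obtain ⟨-, ⟨s, ⟨w, hw, p, hp⟩, rfl⟩, hrs⟩ := lt_sSup_iff.1 h
  have h0 : HasOrder 0 (alphaEM (-s) * v).1 := (hasOrder_zero_of_tendsto hp).congr hw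
  have h1 := (hasOrder_alphaRep s).mul h0
  have e : alphaRep s * (alphaEM (-s) * v).1 = v.1 := by
    change alphaRep s * (alphaRep (-s) * v.1) = v.1
    rw [← mul_assoc, ← alphaRep_add, add_neg_cancel, alphaRep_zero, one_mul]
  rw [e, add_zero] at h1
  have hrs : r < s := EReal.coe_lt_coe_iff.1 hrs
  exact h1.weaken hrs.le

theorem val_ne_bot (x : GC) : val x ≠ ⊥ := by
  obtain ⟨v, rfl⟩ := cl_surjective x
  obtain ⟨r, hr⟩ := IsModerate.hasOrder v.2
  intro h
  have := le_val_of_hasOrder hr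
  rw [h] at this
  exact absurd this (by simp)

theorem gnorm_nonneg (x : GC) : 0 ≤ gnorm x := ENNReal.toReal_nonneg

theorem gnorm_le_exp_iff {x : GC} {r : ℝ} : gnorm x ≤ Real.exp (-r) ↔ (r : EReal) ≤ val x := by
  have h1 : EReal.exp (-val x) ≠ ⊤ := by
    simpa using val_ne_bot x
  rw [gnorm, ← ENNReal.le_ofReal_iff_toReal_le h1 (Real.exp_pos _).le, ← EReal.exp_coe,
    EReal.exp_le_exp_iff, EReal.coe_neg, EReal.neg_le_neg_iff]

theorem gnorm_le_of_hasOrder {r : ℝ} {v : EMNum} (h : HasOrder r v.1) :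
    gnorm (cl v) ≤ Real.exp (-r) :=
  gnorm_le_exp_iff.2 (le_val_of_hasOrder h)

theorem gnorm_lt_exp_iff {x : GC} {r : ℝ} : gnorm x < Real.exp (-r) ↔ (r : EReal) < val x := by
  have h1 : EReal.exp (-val x) ≠ ⊤ := by
    simpa using val_ne_bot x
  rw [gnorm, ← ENNReal.lt_ofReal_iff_toReal_lt h1, ← EReal.exp_coe,
    EReal.exp_lt_exp_iff, EReal.coe_neg, EReal.neg_lt_neg_iff]

theorem hasOrder_of_gnorm_lt {r : ℝ} {v : EMNum} (h : gnorm (cl v) < Real.exp (-r)) :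
    HasOrder r v.1 :=
  hasOrder_of_lt_val (gnorm_lt_exp_iff.1 h)

theorem hasOrder_neg_log {v : EMNum} {R : ℝ} (h : gnorm (cl v) < R) :
    HasOrder (-Real.log R) v.1 := by
  refine hasOrder_of_gnorm_lt ?_
  rwa [neg_neg, Real.exp_log ((gnorm_nonneg _).trans_lt h)]

theorem gnorm_le_of_hasOrder_neg_log {v : EMNum} {R : ℝ} (hR : 0 < R)
    (h : HasOrder (-Real.log R) v.1) : gnorm (cl v) ≤ R := by
  have := gnorm_le_of_hasOrder h
  rwa [neg_neg, Real.exp_log hR] at this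

theorem gnorm_zero : gnorm 0 = 0 := by
  refine le_antisymm (le_of_forall_gt_imp_ge_of_dense fun R hR => ?_) (gnorm_nonneg 0)
  have h : IsNull (0 : EMNum).1 := (0 : NNum).2
  exact gnorm_le_of_hasOrder_neg_log (v := 0) hR (h.hasOrder _)

theorem gnorm_neg (x : GC) : gnorm (-x) = gnorm x := by
  have key : ∀ x, gnorm (-x) ≤ gnorm x := by
    intro x
    refine le_of_forall_gt_imp_ge_of_dense fun R hR => ?_
    obtain ⟨v, rfl⟩ := cl_surjective x
    exact gnorm_le_of_hasOrder_neg_log (v := -v) ((gnorm_nonneg _).trans_lt hR)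
      (hasOrder_neg_log hR).neg
  exact le_antisymm (key x) (by simpa using key (-x))

theorem gnorm_add_le (x y : GC) : gnorm (x + y) ≤ max (gnorm x) (gnorm y) := by
  refine le_of_forall_gt_imp_ge_of_dense fun R hR => ?_
  obtain ⟨v, rfl⟩ := cl_surjective x
  obtain ⟨w, rfl⟩ := cl_surjective y
  rw [max_lt_iff] at hR
  exact gnorm_le_of_hasOrder_neg_log (v := v + w) ((gnorm_nonneg _).trans_lt hR.1)
    ((hasOrder_neg_log hR.1).add (hasOrder_neg_log hR.2))

theorem gnorm_add_le_of_le {x y : GC} {R : ℝ} (hx : gnorm x ≤ R) (hy : gnorm y ≤ R) :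
    gnorm (x + y) ≤ R := (gnorm_add_le x y).trans (max_le hx hy)

theorem gnorm_sub_le_of_le {x y : GC} {R : ℝ} (hx : gnorm x ≤ R) (hy : gnorm y ≤ R) :
    gnorm (x - y) ≤ R := by
  rw [sub_eq_add_neg]
  exact gnorm_add_le_of_le hx (by rwa [gnorm_neg])

theorem gnorm_sum_le {ι : Type} (t : Finset ι) (x : ι → GC) {R : ℝ} (hR : 0 ≤ R)
    (h : ∀ i ∈ t, gnorm (x i) ≤ R) : gnorm (∑ i ∈ t, x i) ≤ R := by
  classical
  induction t using Finset.induction_on with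
  | empty => simpa [gnorm_zero] using hR
  | insert a t ha ih =>
    rw [Finset.sum_insert ha]
    exact gnorm_add_le_of_le (h a (by simp)) (ih fun i hi => h i (by simp [hi]))

theorem gnorm_mul_le (x y : GC) : gnorm (x * y) ≤ gnorm x * gnorm y := by
  have key : ∀ a > gnorm x, ∀ b > gnorm y, gnorm (x * y) ≤ a * b := by
    intro a ha b hb
    obtain ⟨v, rfl⟩ := cl_surjective x
    obtain ⟨w, rfl⟩ := cl_surjective y
    have ha0 := (gnorm_nonneg _).trans_lt ha
    have hb0 := (gnorm_nonneg _).trans_lt hb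
    refine gnorm_le_of_hasOrder_neg_log (v := v * w) (mul_pos ha0 hb0) ?_
    have := (hasOrder_neg_log ha).mul (hasOrder_neg_log hb)
    rw [Real.log_mul ha0.ne' hb0.ne', neg_add]
    exact this
  have hlim : Tendsto (fun t : ℝ => (gnorm x + t) * (gnorm y + t)) (𝓝[>] 0)
      (𝓝 (gnorm x * gnorm y)) := by
    have : Continuous fun t : ℝ => (gnorm x + t) * (gnorm y + t) := by fun_prop
    simpa using (this.tendsto 0).mono_left (nhdsWithin_le_nhds (s := Ioi 0))
  refine ge_of_tendsto hlim ?_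
  filter_upwards [self_mem_nhdsWithin] with t ht
  exact key _ (lt_add_of_pos_right _ ht) _ (lt_add_of_pos_right _ ht)

theorem gnorm_mul_le_of_le {x y : GC} {a b : ℝ} (hx : gnorm x ≤ a) (hy : gnorm y ≤ b) :
    gnorm (x * y) ≤ a * b :=
  (gnorm_mul_le x y).trans
    (mul_le_mul hx hy (gnorm_nonneg _) ((gnorm_nonneg _).trans hx))

theorem gnorm_algebraMap_le (c : ℂ) : gnorm (algebraMap ℂ GC c) ≤ 1 := by
  have := gnorm_le_of_hasOrder (v := algebraMap ℂ EMNum c) (hasOrder_const c)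
  rwa [neg_zero, Real.exp_zero] at this

theorem gnorm_algebraMap_mul_le (c : ℂ) (x : GC) : gnorm (algebraMap ℂ GC c * x) ≤ gnorm x := by
  simpa using gnorm_mul_le_of_le (gnorm_algebraMap_le c) (le_refl (gnorm x))

theorem gnorm_algebraMap_mul {c : ℂ} (hc : c ≠ 0) (x : GC) :
    gnorm (algebraMap ℂ GC c * x) = gnorm x := by
  refine le_antisymm (gnorm_algebraMap_mul_le c x) ?_
  have := gnorm_algebraMap_mul_le c⁻¹ (algebraMap ℂ GC c * x)
  rwa [← mul_assoc, ← map_mul, inv_mul_cancel₀ hc, map_one, one_mul] at this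

theorem gnorm_natCast_mul_le (n : ℕ) (x : GC) : gnorm (n * x) ≤ gnorm x := by
  simpa using gnorm_algebraMap_mul_le n x

theorem gnorm_one_le : gnorm 1 ≤ 1 := by
  simpa using gnorm_algebraMap_le 1

theorem gnorm_pow_le (x : GC) (n : ℕ) : gnorm (x ^ n) ≤ gnorm x ^ n := by
  induction n with
  | zero => simpa using gnorm_one_le
  | succ n ih =>
    rw [pow_succ, pow_succ]
    exact gnorm_mul_le_of_le ih le_rfl

theorem gnorm_alpha_le (r : ℝ) : gnorm (alpha r) ≤ Real.exp (-r) :=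
  gnorm_le_of_hasOrder (v := alphaEM r) (hasOrder_alphaRep r)

theorem gnorm_alpha_mul (r : ℝ) (x : GC) : gnorm (alpha r * x) = Real.exp (-r) * gnorm x := by
  refine le_antisymm (gnorm_mul_le_of_le (gnorm_alpha_le r) le_rfl) ?_
  have := gnorm_mul_le_of_le (gnorm_alpha_le (-r)) (le_refl (gnorm (alpha r * x)))
  rw [alpha_neg_mul, neg_neg] at this
  calc _ ≤ Real.exp (-r) * (Real.exp r * gnorm (alpha r * x)) := by gcongr
    _ = _ := by rw [← mul_assoc, ← Real.exp_add, neg_add_cancel, Real.exp_zero, one_mul]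

theorem gnorm_alpha_pow_mul (r : ℝ) (n : ℕ) (x : GC) :
    gnorm (alpha r ^ n * x) = Real.exp (-r) ^ n * gnorm x := by
  induction n with
  | zero => simp
  | succ n ih => rw [pow_succ', mul_assoc, gnorm_alpha_mul, ih, pow_succ', mul_assoc]

section calculus

variable {Ω : TopologicalSpace.Opens ℂ} {g : ℂ → ℂ}

/-! ### Wirtinger calculus -/

/-- The real linear map `v ↦ a v + b v̄` on `ℂ`. -/
noncomputable def wirt (a b : ℂ) : ℂ →L[ℝ] ℂ :=
  a • (1 : ℂ →L[ℝ] ℂ) + b • (Complex.conjCLE : ℂ →L[ℝ] ℂ)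

@[simp]
theorem wirt_apply (a b v : ℂ) : wirt a b v = a * v + b * (starRingEnd ℂ) v := by
  simp [wirt]

theorem norm_wirt_le (a b : ℂ) : ‖wirt a b‖ ≤ ‖a‖ + ‖b‖ := by
  refine ContinuousLinearMap.opNorm_le_bound _ (by positivity) fun v => ?_
  rw [wirt_apply, add_mul]
  exact (norm_add_le _ _).trans (by simp)

theorem fderiv_eq_wirt (g : ℂ → ℂ) (z : ℂ) : fderiv ℝ g z = wirt (dz g z) (dzbar g z) := by
  ext v
  have hv : v = v.re • (1 : ℂ) + v.im • Complex.I := by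
    simp
  have h2 : (starRingEnd ℂ) v = v.re - v.im * Complex.I := by
    simp [Complex.ext_iff]
  have h3 : v = v.re + v.im * Complex.I := (Complex.re_add_im v).symm
  rw [wirt_apply, h2]
  conv_lhs => rw [hv, map_add, map_smul, map_smul, Complex.real_smul, Complex.real_smul]
  nth_rw 3 [h3]
  simp only [dz, dzbar]
  linear_combination ((v.im : ℂ) * fderiv ℝ g z Complex.I) * Complex.I_sq

/-- The linear map sending `fderiv ℝ g z` to `dz g z`. -/
noncomputable def dzL : (ℂ →L[ℝ] ℂ) →L[ℝ] ℂ :=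
  (2⁻¹ : ℝ) • (ContinuousLinearMap.apply ℝ ℂ (1 : ℂ) -
    (ContinuousLinearMap.mul ℝ ℂ Complex.I).comp (ContinuousLinearMap.apply ℝ ℂ Complex.I))

theorem dz_eq (g : ℂ → ℂ) : dz g = dzL ∘ fderiv ℝ g := by
  ext z
  simp [dz, dzL]
  ring

theorem contDiffOn_dz (hg : ContDiffOn ℝ ∞ g Ω) : ContDiffOn ℝ ∞ (dz g) Ω := by
  rw [dz_eq]
  exact dzL.contDiff.comp_contDiffOn (contDiffOn_fderiv_of hg)

theorem contDiffOn_dzbar (hg : ContDiffOn ℝ ∞ g Ω) : ContDiffOn ℝ ∞ (dzbar g) Ω := by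
  rw [dzbar_eq]
  exact dzbarL.contDiff.comp_contDiffOn (contDiffOn_fderiv_of hg)

theorem contDiffOn_iterate_dz (hg : ContDiffOn ℝ ∞ g Ω) (n : ℕ) :
    ContDiffOn ℝ ∞ (dz^[n] g) Ω := by
  induction n with
  | zero => exact hg
  | succ n ih =>
    rw [Function.iterate_succ_apply']
    exact contDiffOn_dz ih

theorem norm_iteratedFDeriv_dz_le (hg : ContDiffOn ℝ ∞ g Ω) {z : ℂ} (hz : z ∈ Ω)
    (n : ℕ) : ‖iteratedFDeriv ℝ n (dz g) z‖ ≤ ‖dzL‖ * ‖iteratedFDeriv ℝ (n + 1) g z‖ := by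
  rw [dz_eq, ← norm_iteratedFDeriv_fderiv]
  refine dzL.norm_iteratedFDeriv_comp_left (N := n) ?_ le_rfl
  exact ((contDiffOn_fderiv_of hg).contDiffAt (Ω.isOpen.mem_nhds hz)).of_le
    (by exact_mod_cast le_top)

theorem differentiableAt_of_mem (hg : ContDiffOn ℝ ∞ g Ω) {z : ℂ} (hz : z ∈ Ω) :
    DifferentiableAt ℝ g z :=
  (contDiffAt_of_mem hg hz 1).differentiableAt (by simp)

theorem hasFDerivAt_wirt (hg : ContDiffOn ℝ ∞ g Ω) {z : ℂ} (hz : z ∈ Ω) :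
    HasFDerivAt g (wirt (dz g z) (dzbar g z)) z := by
  rw [← fderiv_eq_wirt]
  exact (differentiableAt_of_mem hg hz).hasFDerivAt

theorem dzbar_dz (hg : ContDiffOn ℝ ∞ g Ω) {z : ℂ} (hz : z ∈ Ω) :
    dzbar (dz g) z = dz (dzbar g) z := by
  have hd : DifferentiableAt ℝ (fderiv ℝ g) z :=
    ((contDiffOn_fderiv_of hg).contDiffAt (Ω.isOpen.mem_nhds hz)).differentiableAt (by simp)
  have e1 : fderiv ℝ (dz g) z = dzL.comp (fderiv ℝ (fderiv ℝ g) z) := by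
    rw [dz_eq]
    exact (dzL.hasFDerivAt.comp z hd.hasFDerivAt).fderiv
  have e2 : fderiv ℝ (dzbar g) z = dzbarL.comp (fderiv ℝ (fderiv ℝ g) z) := by
    rw [dzbar_eq]
    exact (dzbarL.hasFDerivAt.comp z hd.hasFDerivAt).fderiv
  have hs := (contDiffAt_of_mem hg hz 2).isSymmSndFDerivAt (by simp)
  have := hs.eq 1 Complex.I
  simp only [dzbar, dz, e1, e2]
  simp [dzL, dzbarL, this]
  ring

/-! ### Interior gradient estimate -/

theorem hasDerivAt_comp_circleMap (hg : ContDiffOn ℝ ∞ g Ω) {x : ℂ} {t θ : ℝ}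
    (h : circleMap x t θ ∈ Ω) :
    HasDerivAt (fun θ => g (circleMap x t θ))
      (Complex.I * t * (dz g (circleMap x t θ) * circleMap 0 1 θ -
        dzbar g (circleMap x t θ) * (starRingEnd ℂ) (circleMap 0 1 θ))) θ := by
  refine ((hasFDerivAt_wirt hg h).comp_hasDerivAt θ (hasDerivAt_circleMap x t θ)).congr_deriv ?_
  simp only [wirt_apply, circleMap_zero, map_mul, Complex.conj_I, Complex.conj_ofReal]
  push_cast
  ring

theorem hasDerivAt_comp_circleMap_radius (hg : ContDiffOn ℝ ∞ g Ω) {x : ℂ} {t θ : ℝ}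
    (h : circleMap x t θ ∈ Ω) :
    HasDerivAt (fun t : ℝ => g (circleMap x t θ))
      (wirt (dz g (circleMap x t θ)) (dzbar g (circleMap x t θ)) (circleMap 0 1 θ)) t := by
  refine (hasFDerivAt_wirt hg h).comp_hasDerivAt t ?_
  simp only [circleMap, zero_add, Complex.ofReal_one, one_mul]
  simpa using ((Complex.ofRealCLM.hasDerivAt (x := t)).mul_const
    (Complex.exp (θ * Complex.I))).const_add x

theorem continuous_comp_circleMap {h : ℂ → ℂ} (hh : ContinuousOn h Ω) {x : ℂ} {t : ℝ}
    (ht : Metric.sphere x |t| ⊆ Ω) : Continuous fun θ => h (circleMap x t θ) :=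
  hh.comp_continuous (continuous_circleMap x t) fun θ => ht (circleMap_mem_sphere' x t θ)

theorem continuous_conj_circleMap :
    Continuous fun θ => (starRingEnd ℂ) (circleMap 0 1 θ) :=
  Complex.continuous_conj.comp (continuous_circleMap 0 1)

/-- Integration of the angular derivative over a full circle. -/
theorem integral_dz_circle (hg : ContDiffOn ℝ ∞ g Ω) {x : ℂ} {t : ℝ} (ht0 : t ≠ 0)
    (ht : Metric.sphere x |t| ⊆ Ω) :
    ∫ θ in (0 : ℝ)..2 * Real.pi, dz g (circleMap x t θ) * circleMap 0 1 θ =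
      ∫ θ in (0 : ℝ)..2 * Real.pi,
        dzbar g (circleMap x t θ) * (starRingEnd ℂ) (circleMap 0 1 θ) := by
  have c1 : Continuous fun θ => dz g (circleMap x t θ) * circleMap 0 1 θ :=
    (continuous_comp_circleMap (contDiffOn_dz hg).continuousOn ht).mul (continuous_circleMap 0 1)
  have c2 : Continuous fun θ =>
      dzbar g (circleMap x t θ) * (starRingEnd ℂ) (circleMap 0 1 θ) :=
    (continuous_comp_circleMap (contDiffOn_dzbar hg).continuousOn ht).mul continuous_conj_circleMap
  have h := intervalIntegral.integral_eq_sub_of_hasDerivAt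
    (fun θ _ => hasDerivAt_comp_circleMap hg (ht (circleMap_mem_sphere' x t θ)))
    ((continuous_const.mul (c1.sub c2)).intervalIntegrable 0 (2 * Real.pi))
  rw [intervalIntegral.integral_const_mul, intervalIntegral.integral_sub
    (c1.intervalIntegrable _ _) (c2.intervalIntegrable _ _)] at h
  have e : circleMap x t (2 * Real.pi) = circleMap x t 0 := by
    simpa using periodic_circleMap x t 0
  rw [e, sub_self, mul_eq_zero] at h
  refine sub_eq_zero.1 (h.resolve_left ?_)
  simpa using ht0

theorem integral_wirt_circleMap (a b : ℂ) :
    ∫ θ in (0 : ℝ)..2 * Real.pi, wirt a b (circleMap 0 1 θ) = 0 := by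
  have h : ∀ θ : ℝ, HasDerivAt (fun θ => wirt a b (circleMap 0 1 θ * (-Complex.I)))
      (wirt a b (circleMap 0 1 θ)) θ := by
    intro θ
    refine (wirt a b).hasFDerivAt.comp_hasDerivAt θ ?_
    refine ((hasDerivAt_circleMap 0 1 θ).mul_const (-Complex.I)).congr_deriv ?_
    linear_combination (-circleMap 0 1 θ) * Complex.I_sq
  rw [intervalIntegral.integral_eq_sub_of_hasDerivAt (fun θ _ => h θ)
    (((wirt a b).continuous.comp (continuous_circleMap 0 1)).intervalIntegrable _ _)]
  have e : circleMap 0 1 (2 * Real.pi) = circleMap 0 1 0 := by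
    simpa using periodic_circleMap 0 1 0
  simp only [e, sub_self]

/-- The radial derivative of the circular means is an integral of `∂̄g` alone. -/
theorem norm_integral_radial_le (hg : ContDiffOn ℝ ∞ g Ω) {x : ℂ} {t B : ℝ} (hB0 : 0 ≤ B)
    (ht : Metric.sphere x |t| ⊆ Ω) (hB : ∀ z ∈ Metric.sphere x |t|, ‖dzbar g z‖ ≤ B) :
    ‖∫ θ in (0 : ℝ)..2 * Real.pi,
      wirt (dz g (circleMap x t θ)) (dzbar g (circleMap x t θ)) (circleMap 0 1 θ)‖
      ≤ 4 * Real.pi * B := by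
  rcases eq_or_ne t 0 with rfl | ht0
  · have : ∀ θ, circleMap x 0 θ = x := by simp
    simp only [this]
    rw [integral_wirt_circleMap, norm_zero]
    positivity
  have c1 : Continuous fun θ => dz g (circleMap x t θ) * circleMap 0 1 θ :=
    (continuous_comp_circleMap (contDiffOn_dz hg).continuousOn ht).mul (continuous_circleMap 0 1)
  have c2 : Continuous fun θ =>
      dzbar g (circleMap x t θ) * (starRingEnd ℂ) (circleMap 0 1 θ) :=
    (continuous_comp_circleMap (contDiffOn_dzbar hg).continuousOn ht).mul continuous_conj_circleMap
  simp only [wirt_apply]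
  rw [intervalIntegral.integral_add (c1.intervalIntegrable _ _) (c2.intervalIntegrable _ _),
    integral_dz_circle hg ht0 ht, ← two_mul, norm_mul]
  have h := intervalIntegral.norm_integral_le_of_norm_le_const (a := 0) (b := 2 * Real.pi)
    (f := fun θ => dzbar g (circleMap x t θ) * (starRingEnd ℂ) (circleMap 0 1 θ)) (C := B)
    fun θ _ => by simpa using hB _ (circleMap_mem_sphere' x t θ)
  rw [sub_zero, abs_of_pos Real.two_pi_pos] at h
  simp only [Complex.norm_ofNat]
  linarith

theorem hasDerivAt_integral_circle (hg : ContDiffOn ℝ ∞ g Ω) {x : ℂ} {R t : ℝ}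
    (hR : Metric.closedBall x R ⊆ Ω) (ht : |t| < R) :
    HasDerivAt (fun t : ℝ => ∫ θ in (0 : ℝ)..2 * Real.pi, g (circleMap x t θ))
      (∫ θ in (0 : ℝ)..2 * Real.pi,
        wirt (dz g (circleMap x t θ)) (dzbar g (circleMap x t θ)) (circleMap 0 1 θ)) t := by
  have hs : ∀ s ∈ Ioo (-R) R, Metric.sphere x |s| ⊆ Metric.closedBall x R := fun s hs =>
    Metric.sphere_subset_closedBall.trans (Metric.closedBall_subset_closedBall (abs_lt.2 hs).le)
  obtain ⟨M, hM⟩ := (isCompact_closedBall x R).exists_bound_of_continuousOn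
    ((contDiffOn_fderiv_of hg).continuousOn.mono hR)
  have ht' : t ∈ Ioo (-R) R := abs_lt.1 ht
  have hc : Continuous fun θ =>
      wirt (dz g (circleMap x t θ)) (dzbar g (circleMap x t θ)) (circleMap 0 1 θ) := by
    simp only [wirt_apply]
    exact ((continuous_comp_circleMap (contDiffOn_dz hg).continuousOn ((hs t ht').trans hR)).mul
      (continuous_circleMap 0 1)).add ((continuous_comp_circleMap
        (contDiffOn_dzbar hg).continuousOn ((hs t ht').trans hR)).mul continuous_conj_circleMap)
  refine (intervalIntegral.hasDerivAt_integral_of_dominated_loc_of_deriv_le (𝕜 := ℝ)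
    (F := fun t θ => g (circleMap x t θ)) (F' := fun t θ =>
      wirt (dz g (circleMap x t θ)) (dzbar g (circleMap x t θ)) (circleMap 0 1 θ))
    (bound := fun _ => M) (Ioo_mem_nhds ht'.1 ht'.2) ?_ ?_ ?_ ?_ ?_ ?_).2
  · filter_upwards [Ioo_mem_nhds ht'.1 ht'.2] with s hs'
    exact (continuous_comp_circleMap hg.continuousOn ((hs s hs').trans hR)).aestronglyMeasurable
  · exact (continuous_comp_circleMap hg.continuousOn
      ((hs t ht').trans hR)).intervalIntegrable _ _
  · exact hc.aestronglyMeasurable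
  · refine Eventually.of_forall fun θ _ s hs' => ?_
    rw [← fderiv_eq_wirt]
    refine (ContinuousLinearMap.le_opNorm _ _).trans ?_
    simpa using hM _ (hs s hs' (circleMap_mem_sphere' x s θ))
  · exact intervalIntegrable_const
  · exact Eventually.of_forall fun θ _ s hs' =>
      hasDerivAt_comp_circleMap_radius hg (hR (hs s hs' (circleMap_mem_sphere' x s θ)))

/-- The mean value property up to an error controlled by `∂̄g`. -/
theorem norm_integral_circle_sub_le (hg : ContDiffOn ℝ ∞ g Ω) {x : ℂ} {r R B : ℝ} (hr : 0 ≤ r)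
    (hrR : r < R) (hR : Metric.closedBall x R ⊆ Ω)
    (hB : ∀ z ∈ Metric.closedBall x r, ‖dzbar g z‖ ≤ B) :
    ‖(∫ θ in (0 : ℝ)..2 * Real.pi, g (circleMap x r θ)) - 2 * Real.pi * g x‖
      ≤ 4 * Real.pi * B * r := by
  have hB0 : 0 ≤ B := (norm_nonneg _).trans (hB x (Metric.mem_closedBall_self hr))
  have h := norm_image_sub_le_of_norm_deriv_le_segment' (a := 0) (b := r)
    (f := fun t : ℝ => ∫ θ in (0 : ℝ)..2 * Real.pi, g (circleMap x t θ))
    (C := 4 * Real.pi * B)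
    (fun t ht => (hasDerivAt_integral_circle hg hR
      (by rw [abs_of_nonneg ht.1]; exact ht.2.trans_lt hrR)).hasDerivWithinAt)
    (fun t ht => by
      have e : |t| = t := abs_of_nonneg ht.1
      have hs : Metric.sphere x |t| ⊆ Metric.closedBall x r := by
        rw [e]
        exact Metric.sphere_subset_closedBall.trans (Metric.closedBall_subset_closedBall ht.2.le)
      exact norm_integral_radial_le hg hB0
        (hs.trans ((Metric.closedBall_subset_closedBall hrR.le).trans hR))
        fun z hz => hB z (hs hz)) r (right_mem_Icc.2 hr)
  simpa using h

theorem norm_integral_dz_circle_le (hg : ContDiffOn ℝ ∞ g Ω) {x : ℂ} {r M B : ℝ} (hr : 0 < r)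
    (hR : Metric.closedBall x r ⊆ Ω) (hM : ∀ z ∈ Metric.closedBall x r, ‖g z‖ ≤ M)
    (hB : ∀ z ∈ Metric.closedBall x r, ‖dzbar g z‖ ≤ B) :
    ‖∫ θ in (0 : ℝ)..2 * Real.pi, dz g (circleMap x r θ)‖
      ≤ 2 * Real.pi * (M / r + B) := by
  have hs' : Metric.sphere x |r| ⊆ Metric.closedBall x r := by
    rw [abs_of_pos hr]
    exact Metric.sphere_subset_closedBall
  have hs := hs'.trans hR
  have hmem := fun θ => hs' (circleMap_mem_sphere' x r θ)
  set e : ℝ → ℂ := fun θ => (starRingEnd ℂ) (circleMap 0 1 θ) with he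
  have hee : ∀ θ, circleMap 0 1 θ * e θ = 1 := fun θ => by
    rw [he, Complex.mul_conj]
    simp [Complex.normSq_eq_norm_sq]
  have hde : ∀ θ, HasDerivAt e (-Complex.I * e θ) θ := fun θ => by
    refine ((Complex.conjCLE : ℂ →L[ℝ] ℂ).hasFDerivAt.comp_hasDerivAt θ
      (hasDerivAt_circleMap 0 1 θ)).congr_deriv ?_
    simp [he, mul_comm]
  have ce : Continuous e := continuous_conj_circleMap
  have c0 := continuous_comp_circleMap hg.continuousOn hs
  have c1 := continuous_comp_circleMap (contDiffOn_dz hg).continuousOn hs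
  have c2 := continuous_comp_circleMap (contDiffOn_dzbar hg).continuousOn hs
  -- integrate the angular derivative of `g e` over the full circle
  have hd : ∀ θ, HasDerivAt (fun θ => g (circleMap x r θ) * e θ)
      (Complex.I * (r * dz g (circleMap x r θ) - (r * (dzbar g (circleMap x r θ) * e θ ^ 2) +
        g (circleMap x r θ) * e θ))) θ := by
    intro θ
    refine ((hasDerivAt_comp_circleMap hg (hs (circleMap_mem_sphere' x r θ))).mul
      (hde θ)).congr_deriv ?_
    change Complex.I * r * (_ - _ * e θ) * e θ + _ = _
    linear_combination (Complex.I * r * dz g (circleMap x r θ)) * hee θ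
  have c3 : Continuous fun θ => (r : ℂ) * dz g (circleMap x r θ) := continuous_const.mul c1
  have c4 : Continuous fun θ => (r : ℂ) * (dzbar g (circleMap x r θ) * e θ ^ 2) +
      g (circleMap x r θ) * e θ :=
    (continuous_const.mul (c2.mul (ce.pow 2))).add (c0.mul ce)
  have h := intervalIntegral.integral_eq_sub_of_hasDerivAt (fun θ _ => hd θ)
    ((continuous_const.mul (c3.sub c4)).intervalIntegrable 0 (2 * Real.pi))
  have e1 : ∀ c : ℂ, ∀ t : ℝ, circleMap c t (2 * Real.pi) = circleMap c t 0 := fun c t => by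
    simpa using periodic_circleMap c t 0
  simp only [he, e1, sub_self] at h
  rw [intervalIntegral.integral_const_mul, intervalIntegral.integral_sub
    (c3.intervalIntegrable _ _) (c4.intervalIntegrable _ _), mul_eq_zero] at h
  have h := sub_eq_zero.1 (h.resolve_left Complex.I_ne_zero)
  rw [intervalIntegral.integral_const_mul] at h
  have hn := intervalIntegral.norm_integral_le_of_norm_le_const (a := 0) (b := 2 * Real.pi)
    (f := fun θ => (r : ℂ) * (dzbar g (circleMap x r θ) * e θ ^ 2) + g (circleMap x r θ) * e θ)
    (C := r * B + M) fun θ _ => by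
      refine (norm_add_le _ _).trans (add_le_add ?_ ?_)
      · simpa [he, abs_of_pos hr, hr] using hB _ (hmem θ)
      · simpa [he] using hM _ (hmem θ)
  rw [sub_zero, abs_of_pos Real.two_pi_pos, ← h, norm_mul, Complex.norm_real,
    Real.norm_of_nonneg hr.le] at hn
  rw [← mul_le_mul_iff_right₀ hr]
  refine hn.trans (le_of_eq ?_)
  field_simp
  ring

/-- Interior gradient estimate: `∂g` is controlled by `g`, up to multiples of `∂̄g` and `∂̄∂g`.
This is Cauchy's estimate when `g` is holomorphic. -/
theorem norm_dz_le (hg : ContDiffOn ℝ ∞ g Ω) {x : ℂ} {r M B B' : ℝ} (hr : 0 < r)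
    (hR : Metric.closedBall x r ⊆ Ω) (hM : ∀ z ∈ Metric.closedBall x r, ‖g z‖ ≤ M)
    (hB : ∀ z ∈ Metric.closedBall x r, ‖dzbar g z‖ ≤ B)
    (hB' : ∀ z ∈ Metric.closedBall x r, ‖dzbar (dz g) z‖ ≤ B') :
    ‖dz g x‖ ≤ M / r + B + 2 * B' * r := by
  obtain ⟨δ, hδ, hδΩ⟩ := (isCompact_closedBall x r).exists_cthickening_subset_open Ω.isOpen hR
  rw [cthickening_closedBall hδ.le hr.le] at hδΩ
  have h1 := norm_integral_circle_sub_le (contDiffOn_dz hg) hr.le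
    (lt_add_of_pos_left r hδ) hδΩ hB'
  have h2 := norm_integral_dz_circle_le hg hr hR hM hB
  have h3 : ‖2 * Real.pi * dz g x‖ = 2 * Real.pi * ‖dz g x‖ := by
    simp [abs_of_pos Real.pi_pos]
  have h4 := norm_sub_norm_le (2 * Real.pi * dz g x)
    (∫ θ in (0 : ℝ)..2 * Real.pi, dz g (circleMap x r θ))
  rw [norm_sub_rev, h3] at h4
  rw [← mul_le_mul_iff_right₀ Real.two_pi_pos]
  linarith

/-! ### Taylor formulas -/

theorem norm_sub_sub_wirt_le (hg : ContDiffOn ℝ ∞ g Ω) {x y : ℂ} {M : ℝ}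
    (hs : segment ℝ x y ⊆ Ω) (hM : ∀ z ∈ segment ℝ x y, ‖iteratedFDeriv ℝ 2 g z‖ ≤ M) :
    ‖g y - g x - wirt (dz g x) (dzbar g x) (y - x)‖ ≤ M * ‖y - x‖ ^ 2 := by
  have hx := left_mem_segment ℝ x y
  have hM0 : 0 ≤ M := (norm_nonneg _).trans (hM x hx)
  have hd : ∀ z ∈ segment ℝ x y, DifferentiableAt ℝ (fderiv ℝ g) z := fun z hz =>
    ((contDiffOn_fderiv_of hg).contDiffAt (Ω.isOpen.mem_nhds (hs hz))).differentiableAt (by simp)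
  have h1 : ∀ z ∈ segment ℝ x y, ‖fderiv ℝ g z - fderiv ℝ g x‖ ≤ M * ‖y - x‖ := by
    intro z hz
    refine ((convex_segment x y).norm_image_sub_le_of_norm_fderiv_le (𝕜 := ℝ) (C := M) hd
      (fun w hw => ?_) hx hz).trans ?_
    · rw [← norm_iteratedFDeriv_one, norm_iteratedFDeriv_fderiv]
      exact hM w hw
    · exact mul_le_mul_of_nonneg_left (norm_sub_le_of_mem_segment hz) hM0
  have h2 := (convex_segment x y).norm_image_sub_le_of_norm_fderiv_le' (𝕜 := ℝ)
    (fun z hz => differentiableAt_of_mem hg (hs hz)) h1 hx (right_mem_segment ℝ x y)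
  rw [fderiv_eq_wirt] at h2
  exact h2.trans (le_of_eq (by ring))

/-- The Taylor polynomial in `∂/∂z` at `y`, as a function of its centre `ξ`. -/
noncomputable def dzTaylor (g : ℂ → ℂ) (y : ℂ) (m : ℕ) (ξ : ℂ) : ℂ :=
  ∑ j ∈ Finset.range m, dz^[j] g ξ * (1 / (j.factorial : ℂ) * (y - ξ) ^ j)

/-- Differentiating a Taylor polynomial with respect to its centre, all terms cancel except for the
last one and those with `∂̄∂^j g`. -/
theorem hasFDerivAt_dzTaylor (hg : ContDiffOn ℝ ∞ g Ω) (y : ℂ) (m : ℕ) {ξ : ℂ} (hξ : ξ ∈ Ω) :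
    HasFDerivAt (dzTaylor g y (m + 1))
      (wirt (dz^[m + 1] g ξ * (1 / (m.factorial : ℂ) * (y - ξ) ^ m))
        (∑ j ∈ Finset.range (m + 1),
          dzbar (dz^[j] g) ξ * (1 / (j.factorial : ℂ) * (y - ξ) ^ j))) ξ := by
  have hpow : ∀ j : ℕ, HasFDerivAt (fun ξ : ℂ => (y - ξ) ^ j)
      (wirt (-(j * (y - ξ) ^ (j - 1))) 0) ξ := by
    intro j
    have h := (((hasDerivAt_id ξ).const_sub y).pow j).hasFDerivAt.restrictScalars ℝ
    refine h.congr_fderiv ?_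
    ext v
    simp
    ring
  have hterm : ∀ j : ℕ, HasFDerivAt
      (fun ξ => dz^[j] g ξ * (1 / (j.factorial : ℂ) * (y - ξ) ^ j))
      (wirt (dz^[j + 1] g ξ * (1 / (j.factorial : ℂ) * (y - ξ) ^ j) -
          dz^[j] g ξ * (1 / (j.factorial : ℂ) * (j * (y - ξ) ^ (j - 1))))
        (dzbar (dz^[j] g) ξ * (1 / (j.factorial : ℂ) * (y - ξ) ^ j))) ξ := by
    intro j
    have h := (hasFDerivAt_wirt (contDiffOn_iterate_dz hg j) hξ).mul
      ((hpow j).const_mul (1 / (j.factorial : ℂ)))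
    refine h.congr_fderiv ?_
    ext v
    simp only [Function.iterate_succ_apply', add_apply,
      smul_apply, wirt_apply, smul_eq_mul]
    ring
  induction m with
  | zero =>
    refine (hterm 0).congr_fderiv ?_ |>.congr_of_eventuallyEq ?_
    · simp
    · exact Eventually.of_forall fun ξ => by simp [dzTaylor]
  | succ m ih =>
    have h := ih.add (hterm (m + 1))
    have e : dzTaylor g y (m + 1 + 1) = dzTaylor g y (m + 1) +
        fun ξ => dz^[m + 1] g ξ * (1 / ((m + 1).factorial : ℂ) * (y - ξ) ^ (m + 1)) := by
      ext ξ
      simp only [dzTaylor, Pi.add_apply]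
      rw [Finset.sum_range_succ]
    rw [e]
    refine h.congr_fderiv ?_
    have hf : ((m + 1).factorial : ℂ) = (m + 1) * m.factorial := by
      push_cast [Nat.factorial_succ]
      ring
    have h0 : ((m : ℂ) + 1) ≠ 0 := Nat.cast_add_one_ne_zero m
    have h1 : (m.factorial : ℂ) ≠ 0 := Nat.cast_ne_zero.2 m.factorial_ne_zero
    have h2 : 1 / ((m + 1).factorial : ℂ) * (((m + 1 : ℕ) : ℂ) * (y - ξ) ^ (m + 1 - 1)) =
        1 / (m.factorial : ℂ) * (y - ξ) ^ m := by
      rw [hf, Nat.add_sub_cancel]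
      push_cast
      field_simp
    rw [h2, Finset.sum_range_succ _ (m + 1)]
    ext v
    simp only [add_apply, wirt_apply]
    ring

/-- Taylor's formula in `∂/∂z`, with an error term which vanishes for holomorphic functions. -/
theorem norm_dzTaylor_sub_le (hg : ContDiffOn ℝ ∞ g Ω) {x y : ℂ} (m : ℕ) {M B : ℝ}
    (hs : segment ℝ x y ⊆ Ω) (hxy : ‖y - x‖ ≤ 1)
    (hM : ∀ z ∈ segment ℝ x y, ‖dz^[m + 1] g z‖ ≤ M)
    (hB : ∀ j ∈ Finset.range (m + 1), ∀ z ∈ segment ℝ x y, ‖dzbar (dz^[j] g) z‖ ≤ B) :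
    ‖dzTaylor g y (m + 1) x - g y‖ ≤ M * ‖y - x‖ ^ (m + 1) + (m + 1) * B := by
  have hx := left_mem_segment ℝ x y
  have hM0 : 0 ≤ M := (norm_nonneg _).trans (hM x hx)
  have hB0 : 0 ≤ B := (norm_nonneg _).trans (hB 0 (by simp) x hx)
  have hfac : ∀ j : ℕ, ‖1 / (j.factorial : ℂ)‖ ≤ 1 := fun j => by
    rw [norm_div, norm_one, Complex.norm_natCast]
    exact div_le_one_of_le₀ (by exact_mod_cast j.factorial_pos) (by positivity)
  have key := (convex_segment x y).norm_image_sub_le_of_norm_hasFDerivWithin_le (𝕜 := ℝ)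
    (f := dzTaylor g y (m + 1)) (C := M * ‖y - x‖ ^ m + (m + 1) * B)
    (fun z hz => (hasFDerivAt_dzTaylor hg y m (hs hz)).hasFDerivWithinAt)
    (fun z hz => ?_) (right_mem_segment ℝ x y) hx
  · have e : dzTaylor g y (m + 1) y = g y := by
      simp [dzTaylor, Finset.sum_range_succ']
    rw [e, norm_sub_rev x y] at key
    refine key.trans ?_
    rw [add_mul, pow_succ, ← mul_assoc]
    exact add_le_add le_rfl (mul_le_of_le_one_right (by positivity) hxy)
  · have hz' : ‖y - z‖ ≤ ‖y - x‖ := by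
      rw [segment_symm] at hz
      have := norm_sub_le_of_mem_segment hz
      rwa [norm_sub_rev z y, norm_sub_rev x y] at this
    refine (norm_wirt_le _ _).trans (add_le_add ?_ ?_)
    · rw [norm_mul, norm_mul, norm_pow]
      have := mul_le_mul (hfac m) (pow_le_pow_left₀ (norm_nonneg _) hz' m)
        (by positivity) zero_le_one
      rw [one_mul] at this
      exact mul_le_mul (hM z hz) this (by positivity) hM0
    · refine (norm_sum_le_of_le _ (f := fun _ => _) (n := fun _ => B) fun j hj => ?_).trans (by simp)
      rw [norm_mul, norm_mul, norm_pow]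
      have := mul_le_mul (hfac j) (pow_le_one₀ (norm_nonneg _) (hz'.trans hxy) (n := j))
        (by positivity) zero_le_one
      rw [one_mul] at this
      simpa using mul_le_mul (hB j hj z hz) this (by positivity) hB0

end calculus

/-! ### Generalized functions and their points -/

section families

variable {Ω : TopologicalSpace.Opens ℂ}

/-- `∂/∂z` on representatives. -/
noncomputable def dzEM (u : EM Ω) : EM Ω :=
  ⟨fun φ => dz (u.1 φ), fun φ => contDiffOn_dz (u.2.1 φ),
    fun K hK hK' n => ((uModerate_const ‖dzL‖).mul (u.2.2 K hK hK' (n + 1))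
      fun _ _ => norm_nonneg _).mono
        fun φ _ hz => norm_iteratedFDeriv_dz_le (u.2.1 φ) (hK hz) n⟩

theorem dzEM_iterate_apply (u : EM Ω) (n : ℕ) (φ : A0) :
    (dzEM^[n] u).1 φ = dz^[n] (u.1 φ) := by
  induction n with
  | zero => rfl
  | succ n ih =>
    rw [Function.iterate_succ_apply', Function.iterate_succ_apply', ← ih]
    rfl

/-- The families for which `∂̄u` is negligible, that is, the representatives of holomorphic
generalized functions. -/
def IsHolFamily (u : EM Ω) : Prop := IsNullFun Ω (dzbarEM u).1

theorem IsHolomorphic.isHolFamily {u : EM Ω} (h : IsHolomorphic (clF u)) : IsHolFamily u :=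
  (Ideal.Quotient.eq_zero_iff_mem (I := NF Ω)).1 h

theorem isHolFamily_dzEM {u : EM Ω} (h : IsHolFamily u) : IsHolFamily (dzEM u) := by
  intro K hK hK' n
  refine ((uModerate_const ‖dzL‖).mul_null (h K hK hK' (n + 1))
    fun _ _ => norm_nonneg _).mono fun φ z hz => ?_
  refine le_trans (le_of_eq ?_) (norm_iteratedFDeriv_dz_le ((dzbarEM u).2.1 φ) (hK hz) n)
  refine congrArg _ (Filter.EventuallyEq.eq_of_nhds (Filter.EventuallyEq.iteratedFDeriv ℝ ?_ n))
  filter_upwards [Ω.isOpen.mem_nhds (hK hz)] with y hy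
  exact dzbar_dz (u.2.1 φ) hy

theorem IsHolFamily.iterate {u : EM Ω} (h : IsHolFamily u) (n : ℕ) :
    IsHolFamily (dzEM^[n] u) := by
  induction n with
  | zero => exact h
  | succ n ih =>
    rw [Function.iterate_succ_apply']
    exact isHolFamily_dzEM ih

/-- The family `w` of functions is `O(ε^r)` uniformly on `s`. -/
def UHasOrder (s : Set ℂ) (r : ℝ) (w : A0 → ℂ → ℂ) : Prop :=
  ∃ q : ℕ, ∀ φ ∈ A q, ∃ c > 0, ∀ᶠ ε in 𝓝[>] (0 : ℝ), ∀ z ∈ s, ‖w (scale ε φ) z‖ ≤ c * ε ^ r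

theorem uHasOrder_of_moderate (u : EM Ω) {K : Set ℂ} (hK : K ⊆ Ω) (hK' : IsCompact K) :
    ∃ N : ℝ, UHasOrder K (-N) u.1 := by
  obtain ⟨N, hN⟩ := u.2.2 K hK hK' 0
  simp only [norm_iteratedFDeriv_zero] at hN
  exact ⟨N, N, hN⟩

theorem IsHolFamily.uHasOrder {u : EM Ω} (h : IsHolFamily u) {K : Set ℂ} (hK : K ⊆ Ω)
    (hK' : IsCompact K) (r : ℝ) : UHasOrder K r (fun φ => dzbar (u.1 φ)) := by
  obtain ⟨N, γ, hγ, h⟩ := h K hK hK' 0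
  obtain ⟨n₀, hn₀⟩ := eventually_atTop.1 (tendsto_atTop.1 hγ.2.2 (N + r))
  refine ⟨max N n₀, fun φ hφ => ?_⟩
  obtain ⟨c, hc, h⟩ := h (max N n₀) (le_max_left _ _) φ hφ
  refine ⟨c, hc, ?_⟩
  filter_upwards [h, eventually_small] with ε h hε z hz
  have e := rpow_le_of_small hε (a := γ (max N n₀) - N) (b := r)
    (by have := hn₀ (max N n₀) (le_max_right _ _); linarith)
  have h := h z hz
  rw [norm_iteratedFDeriv_zero] at h
  exact h.trans (by gcongr)

/-- Cauchy's estimates for holomorphic generalized functions: all the derivatives grow with one and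
the same exponent. -/
theorem IsHolFamily.uHasOrder_iterate {u : EM Ω} (h : IsHolFamily u) {L : Set ℂ} (hL : L ⊆ Ω)
    {r : ℝ} (hr : UHasOrder L r u.1) (n : ℕ) :
    ∀ K ⊆ interior L, IsCompact K → UHasOrder K r (fun φ => dz^[n] (u.1 φ)) := by
  induction n with
  | zero =>
    intro K hK _
    obtain ⟨q, hq⟩ := hr
    refine ⟨q, fun φ hφ => ?_⟩
    obtain ⟨c, hc, hq⟩ := hq φ hφ
    refine ⟨c, hc, ?_⟩
    filter_upwards [hq] with ε hq z hz using hq z (interior_subset (hK hz))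
  | succ n ih =>
    intro K hK hK'
    obtain ⟨δ, hδ, hδL⟩ := hK'.exists_cthickening_subset_open isOpen_interior hK
    have hδΩ : Metric.cthickening δ K ⊆ Ω := hδL.trans (interior_subset.trans hL)
    have hc := hK'.cthickening (r := δ)
    obtain ⟨q₁, h₁⟩ := ih _ hδL hc
    obtain ⟨q₂, h₂⟩ := (h.iterate n).uHasOrder hδΩ hc r
    obtain ⟨q₃, h₃⟩ := (h.iterate (n + 1)).uHasOrder hδΩ hc r
    simp only [dzEM_iterate_apply] at h₂ h₃
    refine ⟨q₁ + q₂ + q₃, fun φ hφ => ?_⟩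
    obtain ⟨c₁, hc₁, h₁⟩ := h₁ φ (A_anti (by omega) hφ)
    obtain ⟨c₂, hc₂, h₂⟩ := h₂ φ (A_anti (by omega) hφ)
    obtain ⟨c₃, hc₃, h₃⟩ := h₃ φ (A_anti (by omega) hφ)
    refine ⟨c₁ / δ + c₂ + 2 * c₃ * δ, by positivity, ?_⟩
    filter_upwards [h₁, h₂, h₃] with ε h₁ h₂ h₃ z hz
    have hb : Metric.closedBall z δ ⊆ Metric.cthickening δ K :=
      Metric.closedBall_subset_cthickening hz δ
    simp only [Function.iterate_succ_apply'] at h₃ ⊢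
    refine (norm_dz_le (contDiffOn_iterate_dz (u.2.1 _) n) hδ (hb.trans hδΩ)
      (fun w hw => h₁ w (hb hw)) (fun w hw => h₂ w (hb hw)) fun w hw => h₃ w (hb hw)).trans ?_
    exact le_of_eq (by ring)

theorem HasOrder.congr_eventually {r : ℝ} {v w : A0 → ℂ} (h : HasOrder r v) (q : ℕ)
    (e : ∀ φ ∈ A q, ∀ᶠ ε in 𝓝[>] (0 : ℝ), v (scale ε φ) = w (scale ε φ)) : HasOrder r w := by
  obtain ⟨p, h⟩ := h
  refine ⟨max p q, fun φ hφ => ?_⟩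
  obtain ⟨c, hc, h⟩ := h φ (A_anti (le_max_left _ _) hφ)
  refine ⟨c, hc, ?_⟩
  filter_upwards [h, e φ (A_anti (le_max_right _ _) hφ)] with ε h e
  rwa [← e]

theorem HasOrder.eventually_le {ρ : ℝ} {v : A0 → ℂ} (h : HasOrder ρ v) (hρ : 0 < ρ) {δ : ℝ}
    (hδ : 0 < δ) : ∃ q : ℕ, ∀ φ ∈ A q, ∀ᶠ ε in 𝓝[>] (0 : ℝ), ‖v (scale ε φ)‖ ≤ δ := by
  obtain ⟨q, h⟩ := h
  refine ⟨q, fun φ hφ => ?_⟩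
  obtain ⟨c, hc, h⟩ := h φ hφ
  have h1 : Tendsto (fun ε : ℝ => ε ^ ρ) (𝓝 0) (𝓝 (0 ^ ρ)) :=
    (Real.continuousAt_rpow_const 0 ρ (Or.inr hρ.le)).tendsto
  rw [Real.zero_rpow hρ.ne'] at h1
  have h2 := (h1.mono_left (nhdsWithin_le_nhds (s := Ioi 0))).const_mul c
  rw [mul_zero] at h2
  filter_upwards [h, h2.eventually (gt_mem_nhds hδ)] with ε h h2 using h.trans h2.le

/-- Along `φ_ε`, the segments from `x` to a sufficiently close `y` stay in a fixed compact set. -/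
theorem eventually_segment_subset {x y : A0 → ℂ} {K : Set ℂ} {p : ℕ}
    (hp : ∀ φ ∈ A p, ∀ᶠ ε in 𝓝[>] (0 : ℝ), x (scale ε φ) ∈ K) {ρ : ℝ} (hρ : 0 < ρ)
    (h : HasOrder ρ (y - x)) {δ : ℝ} (hδ : 0 < δ) :
    ∃ q : ℕ, ∀ φ ∈ A q, ∀ᶠ ε in 𝓝[>] (0 : ℝ),
      segment ℝ (x (scale ε φ)) (y (scale ε φ)) ⊆ Metric.cthickening δ K := by
  obtain ⟨q, hq⟩ := h.eventually_le hρ hδ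
  refine ⟨max p q, fun φ hφ => ?_⟩
  filter_upwards [hp φ (A_anti (le_max_left _ _) hφ), hq φ (A_anti (le_max_right _ _) hφ)]
    with ε h1 h2 z hz
  refine Metric.closedBall_subset_cthickening h1 δ (mem_closedBall_iff_norm.2 ?_)
  exact (norm_sub_le_of_mem_segment hz).trans h2

/-- A family close to a compactly supported one may be modified, without changing it along `φ_ε`,
so as to become compactly supported. -/
theorem exists_isCompactlySupported {x y : EMNum} (hx : IsCompactlySupported Ω x.1) {ρ : ℝ}
    (hρ : 0 < ρ) (h : HasOrder ρ (y.1 - x.1)) :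
    ∃ w : EMNum, IsCompactlySupported Ω w.1 ∧ ∃ q : ℕ, ∀ φ ∈ A q, ∀ᶠ ε in 𝓝[>] (0 : ℝ),
      y.1 (scale ε φ) = w.1 (scale ε φ) := by
  classical
  obtain ⟨hxΩ, K, hK, hK', p, hp⟩ := hx
  obtain ⟨δ, hδ, hδΩ⟩ := hK'.exists_cthickening_subset_open Ω.isOpen hK
  obtain ⟨q, hq⟩ := eventually_segment_subset hp hρ h hδ
  have hyK : ∀ φ ∈ A q, ∀ᶠ ε in 𝓝[>] (0 : ℝ), y.1 (scale ε φ) ∈ Metric.cthickening δ K := by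
    intro φ hφ
    filter_upwards [hq φ hφ] with ε hε using hε (right_mem_segment ℝ _ _)
  let w : A0 → ℂ := fun φ => if y.1 φ ∈ Ω then y.1 φ else x.1 φ
  have hyw : ∀ φ ∈ A q, ∀ᶠ ε in 𝓝[>] (0 : ℝ), y.1 (scale ε φ) = w (scale ε φ) := by
    intro φ hφ
    filter_upwards [hyK φ hφ] with ε hε
    exact (if_pos (hδΩ hε)).symm
  obtain ⟨r, hr⟩ := IsModerate.hasOrder y.2
  refine ⟨⟨w, (hr.congr_eventually q hyw).isModerate⟩, ⟨fun φ => ?_, Metric.cthickening δ K, hδΩ,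
    hK'.cthickening, q, fun φ hφ => ?_⟩, q, hyw⟩
  · by_cases hφ : y.1 φ ∈ Ω
    · simp [w, hφ]
    · simpa [w, hφ] using hxΩ φ
  · filter_upwards [hyK φ hφ, hyw φ hφ] with ε h1 h2
    rwa [← h2]

theorem exists_rep_of_gnorm_lt {x : EMNum} (hx : IsCompactlySupported Ω x.1) {ρ : ℝ} (hρ : 0 < ρ)
    {z : GC} (hz : gnorm (z - cl x) < Real.exp (-ρ)) :
    ∃ y : EMNum, cl y = z ∧ IsCompactlySupported Ω y.1 ∧ HasOrder ρ (y.1 - x.1) := by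
  obtain ⟨y, rfl⟩ := cl_surjective z
  have h : HasOrder ρ (y.1 - x.1) := hasOrder_of_gnorm_lt (v := y - x) hz
  obtain ⟨w, hw, q, hq⟩ := exists_isCompactlySupported hx hρ h
  refine ⟨w, (cl_eq_of_eventuallyEq q hq).symm, hw, h.congr_eventually q fun φ hφ => ?_⟩
  filter_upwards [hq φ hφ] with ε hε
  simp [hε]

theorem gball_subset_compactPoints {z₀ : GC} (hz₀ : z₀ ∈ compactPoints Ω) {r : ℝ} (hr : r < 1) :
    gball z₀ r ⊆ compactPoints Ω := by
  obtain ⟨x, rfl, hx⟩ := hz₀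
  intro z hz
  have hr0 : 0 < r := (gnorm_nonneg _).trans_lt hz
  obtain ⟨y, hy, hy', -⟩ := exists_rep_of_gnorm_lt hx (ρ := -Real.log r)
    (by have := Real.log_neg hr0 hr; linarith) (z := z)
    (by rwa [neg_neg, Real.exp_log hr0])
  exact ⟨y, hy, hy'⟩

/-- The first order Taylor formula along generalized points, with a remainder of order `2ρ - N`,
where `N` does not depend on the increment. -/
theorem exists_hasOrder_sub_sub_wirt (u : EM Ω) {x : EMNum} (hx : IsCompactlySupported Ω x.1) :
    ∃ N : ℝ, ∀ ρ > 0, ∀ y : EMNum, HasOrder ρ (y.1 - x.1) →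
      HasOrder (ρ + ρ - N) fun φ => u.1 φ (y.1 φ) - u.1 φ (x.1 φ) -
        wirt (dz (u.1 φ) (x.1 φ)) (dzbar (u.1 φ) (x.1 φ)) (y.1 φ - x.1 φ) := by
  obtain ⟨hxΩ, K, hK, hK', p, hp⟩ := hx
  obtain ⟨δ, hδ, hδΩ⟩ := hK'.exists_cthickening_subset_open Ω.isOpen hK
  obtain ⟨N, hN⟩ := u.2.2 _ hδΩ hK'.cthickening 2
  refine ⟨N, fun ρ hρ y hy => ?_⟩
  obtain ⟨q₁, h₁⟩ := eventually_segment_subset hp hρ hy hδ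
  obtain ⟨q₂, h₂⟩ := hy
  refine ⟨N + q₁ + q₂, fun φ hφ => ?_⟩
  obtain ⟨c, hc, hN⟩ := hN φ (A_anti (by omega) hφ)
  obtain ⟨d, hd, h₂⟩ := h₂ φ (A_anti (by omega) hφ)
  refine ⟨c * d ^ 2, by positivity, ?_⟩
  filter_upwards [hN, h₁ φ (A_anti (by omega) hφ), h₂, eventually_small] with ε hN h₁ h₂ hε
  rw [Pi.sub_apply] at h₂
  refine (norm_sub_sub_wirt_le (u.2.1 _) (h₁.trans hδΩ) fun z hz => hN z (h₁ hz)).trans ?_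
  have h0 := Real.rpow_nonneg hε.1.le (-(N : ℝ))
  calc _ ≤ c * ε ^ (-(N : ℝ)) * (d * ε ^ ρ) ^ 2 := by gcongr
    _ = c * d ^ 2 * (ε ^ ρ * ε ^ ρ * ε ^ (-(N : ℝ))) := by ring
    _ = _ := by rw [← Real.rpow_add hε.1, ← Real.rpow_add hε.1, sub_eq_add_neg]

/-- The Taylor formula for holomorphic generalized functions. The loss `N` in the order of the
remainder does not depend on the order of the Taylor polynomial. -/
theorem IsHolFamily.exists_hasOrder_dzTaylor_sub {u : EM Ω} (h : IsHolFamily u) {x : EMNum}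
    (hx : IsCompactlySupported Ω x.1) :
    ∃ N : ℝ, ∀ y : EMNum, HasOrder 1 (y.1 - x.1) → ∀ m : ℕ,
      HasOrder ((m + 1 : ℕ) - N) fun φ => dzTaylor (u.1 φ) (y.1 φ) (m + 1) (x.1 φ) -
        u.1 φ (y.1 φ) := by
  obtain ⟨hxΩ, K, hK, hK', p, hp⟩ := hx
  obtain ⟨δ, hδ, hδΩ⟩ := hK'.exists_cthickening_subset_open Ω.isOpen hK
  obtain ⟨δ', hδ', hδ'Ω⟩ := hK'.exists_cthickening_subset_open
    (Metric.isOpen_thickening (δ := δ)) (Metric.self_subset_thickening hδ K)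
  have hint : Metric.cthickening δ' K ⊆ interior (Metric.cthickening δ K) :=
    hδ'Ω.trans (Metric.thickening_subset_interior_cthickening δ K)
  have hc' := hK'.cthickening (r := δ')
  have hδ'Ω' := hint.trans (interior_subset.trans hδΩ)
  obtain ⟨N, hN⟩ := uHasOrder_of_moderate u hδΩ hK'.cthickening
  refine ⟨N, fun y hy m => ?_⟩
  obtain ⟨q₁, h₁⟩ := eventually_segment_subset hp one_pos hy hδ'
  obtain ⟨q₂, h₂⟩ := hy.eventually_le one_pos one_pos
  obtain ⟨q₃, h₃⟩ := hy
  obtain ⟨q₄, h₄⟩ := h.uHasOrder_iterate hδΩ hN (m + 1) _ hint hc'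
  choose q₅ h₅ using fun j => (h.iterate j).uHasOrder hδ'Ω' hc' ((m + 1 : ℕ) - N)
  simp only [dzEM_iterate_apply] at h₅
  refine ⟨q₁ + q₂ + q₃ + q₄ + ∑ j ∈ Finset.range (m + 1), q₅ j, fun φ hφ => ?_⟩
  obtain ⟨d, hd, h₃⟩ := h₃ φ (A_anti (by omega) hφ)
  obtain ⟨c, hc, h₄⟩ := h₄ φ (A_anti (by omega) hφ)
  have h₅' : ∀ j ∈ Finset.range (m + 1), ∃ c > 0, ∀ᶠ ε in 𝓝[>] (0 : ℝ),
      ∀ z ∈ Metric.cthickening δ' K,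
        ‖dzbar (dz^[j] (u.1 (scale ε φ))) z‖ ≤ c * ε ^ (((m + 1 : ℕ) : ℝ) - N) := fun j hj =>
    h₅ j φ (A_anti (by
      have := Finset.single_le_sum (f := q₅) (fun _ _ => Nat.zero_le _) hj
      omega) hφ)
  choose! b hb h₅' using h₅'
  refine ⟨c * d ^ (m + 1) + (m + 1) * ∑ j ∈ Finset.range (m + 1), b j, ?_, ?_⟩
  · have := Finset.sum_nonneg fun j hj => (hb j hj).le
    positivity
  filter_upwards [h₁ φ (A_anti (by omega) hφ), h₂ φ (A_anti (by omega) hφ), h₃, h₄,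
    (Filter.eventually_all_finset _).2 h₅', eventually_small] with ε h₁ h₂ h₃ h₄ h₅ hε
  rw [Pi.sub_apply] at h₂ h₃
  rw [Real.rpow_one] at h₃
  have h0 := Real.rpow_nonneg hε.1.le (-N)
  have h0' := Real.rpow_nonneg hε.1.le (((m + 1 : ℕ) : ℝ) - N)
  refine (norm_dzTaylor_sub_le (u.2.1 _) m (B := (∑ j ∈ Finset.range (m + 1), b j) *
    ε ^ (((m + 1 : ℕ) : ℝ) - N)) (h₁.trans hδ'Ω') h₂ (fun z hz => h₄ z (h₁ hz))
    fun j hj z hz => (h₅ j hj z (h₁ hz)).trans ?_).trans ?_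
  · have := Finset.single_le_sum (f := b) (fun j hj => (hb j hj).le) hj
    gcongr
  · have key : c * ε ^ (-N) * ‖y.1 (scale ε φ) - x.1 (scale ε φ)‖ ^ (m + 1) ≤
        c * d ^ (m + 1) * ε ^ (((m + 1 : ℕ) : ℝ) - N) :=
      calc _ ≤ c * ε ^ (-N) * (d * ε) ^ (m + 1) := by gcongr
        _ = c * d ^ (m + 1) * (ε ^ (m + 1) * ε ^ (-N)) := by ring
        _ = _ := by rw [← Real.rpow_natCast ε (m + 1), ← Real.rpow_add hε.1, sub_eq_add_neg]
    rw [add_mul (c * d ^ (m + 1)), mul_assoc ((m : ℝ) + 1)]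
    exact add_le_add_left key _

end families

/-! ### Taylor formulas for point values -/

section kappa

variable {Ω : TopologicalSpace.Opens ℂ}

/-- First order Taylor formula for `κ(u)` for the increments `c α̇_ρ`. -/
theorem exists_gnorm_kappa_add_alpha_le (u : EM Ω) {z₀ : GC} (hz₀ : z₀ ∈ compactPoints Ω) :
    ∃ C ≥ 0, ∀ ρ > 0, ∀ c : ℂ,
      gnorm (kappa (clF u) (z₀ + algebraMap ℂ GC c * alpha ρ) - kappa (clF u) z₀ -
        alpha ρ * (algebraMap ℂ GC c * kappa (clF (dzEM u)) z₀ +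
          algebraMap ℂ GC ((starRingEnd ℂ) c) * kappa (clF (dzbarEM u)) z₀)) ≤
        C * Real.exp (-ρ) ^ 2 := by
  obtain ⟨x, rfl, hx⟩ := hz₀
  obtain ⟨N, hN⟩ := exists_hasOrder_sub_sub_wirt u hx
  refine ⟨Real.exp N, (Real.exp_pos _).le, fun ρ hρ c => ?_⟩
  set h : EMNum := algebraMap ℂ EMNum c * alphaEM ρ with hh
  have ho : HasOrder ρ ((x + h).1 - x.1) := by
    have := (hasOrder_const c).mul (hasOrder_alphaRep ρ)
    rw [zero_add] at this
    have e : (x + h).1 - x.1 = (fun _ => c) * alphaRep ρ := add_sub_cancel_left x.1 h.1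
    rwa [e]
  obtain ⟨y, hy, q, hq⟩ := exists_isCompactlySupported hx hρ ho
  have hyo : HasOrder ρ (y.1 - x.1) := ho.congr_eventually q fun φ hφ => by
    filter_upwards [hq φ hφ] with ε hε
    simp only [Pi.sub_apply, hε]
  have e : cl x + algebraMap ℂ GC c * alpha ρ = cl y := cl_eq_of_eventuallyEq (v := x + h) q hq
  rw [e, kappa_cl u x hx, kappa_cl u y hy, kappa_cl _ x hx, kappa_cl _ x hx]
  have h1 := hN ρ hρ y hyo
  let F : EMNum := pointEval u y hy - pointEval u x hx - alphaEM ρ *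
    (algebraMap ℂ EMNum c * pointEval (dzEM u) x hx +
      algebraMap ℂ EMNum ((starRingEnd ℂ) c) * pointEval (dzbarEM u) x hx)
  have h2 : HasOrder (ρ + ρ - N) F.1 := h1.congr_eventually q fun φ hφ => by
    filter_upwards [hq φ hφ] with ε hε
    have e2 : y.1 (scale ε φ) - x.1 (scale ε φ) = c * alphaRep ρ (scale ε φ) := by
      rw [← hε]
      exact add_sub_cancel_left _ _
    have e3 : (starRingEnd ℂ) (alphaRep ρ (scale ε φ)) = alphaRep ρ (scale ε φ) :=
      Complex.conj_ofReal _
    change _ = u.1 (scale ε φ) (y.1 (scale ε φ)) - u.1 (scale ε φ) (x.1 (scale ε φ)) -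
      alphaRep ρ (scale ε φ) * (c * dz (u.1 (scale ε φ)) (x.1 (scale ε φ)) +
        (starRingEnd ℂ) c * dzbar (u.1 (scale ε φ)) (x.1 (scale ε φ)))
    rw [e2, wirt_apply, map_mul, e3]
    ring
  refine (gnorm_le_of_hasOrder h2).trans (le_of_eq ?_)
  rw [← Real.exp_nat_mul, ← Real.exp_add]
  congr 1
  push_cast
  ring

/-- First order Taylor formula for `κ(u)` when `∂̄u` is negligible. -/
theorem IsHolFamily.exists_gnorm_kappa_sub_le {u : EM Ω} (h : IsHolFamily u) {z₀ : GC}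
    (hz₀ : z₀ ∈ compactPoints Ω) :
    ∃ C ≥ 0, ∀ ρ > 0, ∀ z, gnorm (z - z₀) < Real.exp (-ρ) →
      gnorm (kappa (clF u) z - kappa (clF u) z₀ - kappa (clF (dzEM u)) z₀ * (z - z₀)) ≤
        C * Real.exp (-ρ) ^ 2 := by
  obtain ⟨x, rfl, hx⟩ := hz₀
  obtain ⟨N, hN⟩ := exists_hasOrder_sub_sub_wirt u hx
  have hbar : ∀ r, HasOrder r fun φ => dzbar (u.1 φ) (x.1 φ) := by
    intro r
    obtain ⟨-, K, hK, hK', p, hp⟩ := hx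
    obtain ⟨q, hq⟩ := h.uHasOrder hK hK' r
    refine ⟨p + q, fun φ hφ => ?_⟩
    obtain ⟨c, hc, hq⟩ := hq φ (A_anti (by omega) hφ)
    refine ⟨c, hc, ?_⟩
    filter_upwards [hq, hp φ (A_anti (by omega) hφ)] with ε hq hp using hq _ hp
  refine ⟨Real.exp N, (Real.exp_pos _).le, fun ρ hρ z hz => ?_⟩
  obtain ⟨y, rfl, hy, hyo⟩ := exists_rep_of_gnorm_lt hx hρ hz
  rw [kappa_cl u x hx, kappa_cl u y hy, kappa_cl _ x hx]
  have hconj : HasOrder ρ fun φ => (starRingEnd ℂ) (y.1 φ - x.1 φ) := by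
    simpa only [HasOrder, Complex.norm_conj, Pi.sub_apply] using hyo
  have h3 := (hbar (ρ - N)).mul hconj
  have h1 := (hN ρ hρ y hyo).add (h3.weaken (s := ρ + ρ - N) (by linarith))
  let F : EMNum := pointEval u y hy - pointEval u x hx - pointEval (dzEM u) x hx * (y - x)
  have h2 : HasOrder (ρ + ρ - N) F.1 := by
    convert h1 using 1
    ext φ
    change u.1 φ (y.1 φ) - u.1 φ (x.1 φ) - dz (u.1 φ) (x.1 φ) * (y.1 φ - x.1 φ) =
      u.1 φ (y.1 φ) - u.1 φ (x.1 φ) -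
        wirt (dz (u.1 φ) (x.1 φ)) (dzbar (u.1 φ) (x.1 φ)) (y.1 φ - x.1 φ) +
        dzbar (u.1 φ) (x.1 φ) * (starRingEnd ℂ) (y.1 φ - x.1 φ)
    rw [wirt_apply]
    ring
  refine (gnorm_le_of_hasOrder h2).trans (le_of_eq ?_)
  rw [← Real.exp_nat_mul, ← Real.exp_add]
  congr 1
  push_cast
  ring

/-- `κ(u)` is differentiable with derivative `κ(∂u)`. -/
theorem IsHolFamily.hasGDeriv {u : EM Ω} (h : IsHolFamily u) {z₀ : GC}
    (hz₀ : z₀ ∈ compactPoints Ω) :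
    HasGDeriv (compactPoints Ω) (kappa (clF u)) z₀ (kappa (clF (dzEM u)) z₀) := by
  obtain ⟨C, hC, hC'⟩ := h.exists_gnorm_kappa_sub_le hz₀
  intro ε hε
  refine ⟨min (1 / 2) (ε / (4 * C + 1)), by positivity, fun z _ h0 hz => ?_⟩
  rw [lt_min_iff] at hz
  set t := gnorm (z - z₀) with ht
  -- the exponent of the increment is only known up to an arbitrarily small loss, here a factor 2
  have h1 : Real.exp (-(-Real.log (2 * t))) = 2 * t := by
    rw [neg_neg, Real.exp_log (by positivity)]
  have h2 := hC' (-Real.log (2 * t)) (neg_pos.2 (Real.log_neg (by positivity) (by linarith))) z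
    (by rw [h1]; linarith)
  rw [h1] at h2
  rw [gnorm_alpha_mul, Real.exp_neg, Real.exp_log h0]
  have h3 : t * (4 * C + 1) < ε := (lt_div_iff₀ (by positivity)).1 hz.2
  calc _ ≤ t⁻¹ * (C * (2 * t) ^ 2) := by gcongr
    _ = t * (4 * C) := by field_simp; ring
    _ < ε := by nlinarith

/-- The `n`-th Taylor coefficient `κ(∂^n u)(z₀) / n!` of `κ(u)` at `z₀`. -/
noncomputable def taylorCoeff (u : EM Ω) (z₀ : GC) (n : ℕ) : GC :=
  algebraMap ℂ GC (1 / (n.factorial : ℂ)) * kappa (clF (dzEM^[n] u)) z₀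

theorem partialSum_taylorCoeff_sub (u : EM Ω) {x y : EMNum} (hx : IsCompactlySupported Ω x.1)
    (hy : IsCompactlySupported Ω y.1) (m : ℕ) :
    ∃ F : EMNum, partialSum (taylorCoeff u (cl x)) (cl x) (cl y) m - kappa (clF u) (cl y) = cl F ∧
      F.1 = fun φ => dzTaylor (u.1 φ) (y.1 φ) m (x.1 φ) - u.1 φ (y.1 φ) := by
  refine ⟨∑ n ∈ Finset.range m, algebraMap ℂ EMNum (1 / (n.factorial : ℂ)) *
    pointEval (dzEM^[n] u) x hx * (y - x) ^ n - pointEval u y hy, ?_, ?_⟩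
  · rw [kappa_cl u y hy, partialSum]
    simp only [taylorCoeff, fun n => kappa_cl (dzEM^[n] u) x hx]
    simp only [cl, map_sub, map_sum, map_mul, map_pow]
    rfl
  · ext φ
    simp only [dzTaylor]
    have e : ∀ a b : EMNum, (a - b).1 φ = a.1 φ - b.1 φ := fun _ _ => rfl
    have es : ∀ a : ℕ → EMNum, (∑ n ∈ Finset.range m, a n).1 φ =
        ∑ n ∈ Finset.range m, (a n).1 φ := fun a => by
      change EMNum.val (∑ n ∈ Finset.range m, a n) φ = _
      rw [map_sum, Finset.sum_apply]
      rfl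
    rw [e, es]
    congr 1
    refine Finset.sum_congr rfl fun n _ => ?_
    rw [← dzEM_iterate_apply]
    change 1 / (n.factorial : ℂ) * (dzEM^[n] u).1 φ (x.1 φ) * (y.1 φ - x.1 φ) ^ n = _
    ring

/-- The Taylor series of `κ(u)` converges uniformly on the ball of radius `e⁻¹`. -/
theorem IsHolFamily.convergesUniformlyTo {u : EM Ω} (h : IsHolFamily u) {z₀ : GC}
    (hz₀ : z₀ ∈ compactPoints Ω) :
    ConvergesUniformlyTo (gball z₀ (Real.exp (-1))) (taylorCoeff u z₀) z₀ (kappa (clF u)) := by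
  obtain ⟨x, rfl, hx⟩ := hz₀
  obtain ⟨N, hN⟩ := h.exists_hasOrder_dzTaylor_sub hx
  intro ε hε
  obtain ⟨M, hM⟩ := exists_nat_gt (N - Real.log ε)
  refine ⟨M + 1, fun m hm z hz => ?_⟩
  obtain ⟨y, rfl, hy, hyo⟩ := exists_rep_of_gnorm_lt hx one_pos hz
  obtain ⟨k, rfl⟩ : ∃ k, m = k + 1 := ⟨m - 1, by omega⟩
  obtain ⟨F, hF, hF'⟩ := partialSum_taylorCoeff_sub u hx hy (k + 1)
  rw [hF]
  have h1 := hN y hyo k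
  rw [← hF'] at h1
  refine (gnorm_le_of_hasOrder h1).trans_lt ?_
  rw [← Real.lt_log_iff_exp_lt hε]
  have : (M : ℝ) ≤ ((k + 1 : ℕ) : ℝ) := by exact_mod_cast (by omega)
  linarith

theorem ConvergesUniformlyTo.tendsto {B : Set GC} {a : ℕ → GC} {z₀ : GC} {F : GC → GC}
    (h : ConvergesUniformlyTo B a z₀ F) {z : GC} (hz : z ∈ B) :
    Tendsto (fun m => gnorm (partialSum a z₀ z m - F z)) atTop (𝓝 0) := by
  refine Metric.tendsto_atTop.2 fun ε hε => (h ε hε).imp fun M hM m hm => ?_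
  rw [Real.dist_eq, sub_zero, abs_of_nonneg (gnorm_nonneg _)]
  exact hM m hm z hz

theorem algebraMap_I_mul_I (x : GC) :
    algebraMap ℂ GC Complex.I * (algebraMap ℂ GC Complex.I * x) = -x := by
  rw [← mul_assoc, ← map_mul, Complex.I_mul_I, map_neg, map_one]
  exact neg_one_mul x

/-- A derivative over `ℂ̄` gives the partial derivatives, which satisfy the Cauchy–Riemann
equation. -/
theorem HasGDeriv.hasGDzbar_zero {U : Set GC} {F : GC → GC} {z₀ d : GC}
    (h : HasGDeriv U F z₀ d) : HasGDzbar U F z₀ 0 := by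
  refine ⟨d, algebraMap ℂ GC Complex.I * d, fun ε hε => ?_, fun ε hε => ?_, ?_⟩
  · obtain ⟨δ, hδ, hd⟩ := h ε hε
    refine ⟨δ, hδ, fun k _ hk h0 h1 => ?_⟩
    have := hd (z₀ + k * 1) hk
    rw [add_sub_cancel_left] at this
    simp only [mul_one] at this ⊢
    exact this h0 h1
  · obtain ⟨δ, hδ, hd⟩ := h ε hε
    refine ⟨δ, hδ, fun k _ hk h0 h1 => ?_⟩
    have := hd (z₀ + k * algebraMap ℂ GC Complex.I) hk
    rw [add_sub_cancel_left, mul_comm k, gnorm_algebraMap_mul Complex.I_ne_zero] at this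
    have h2 := this h0 h1
    have e : algebraMap ℂ GC Complex.I * d * k = d * (algebraMap ℂ GC Complex.I * k) := by ring
    rwa [mul_comm k, e]
  · rw [algebraMap_I_mul_I, add_neg_cancel, mul_zero]

end kappa

/-! ### Differentiation of convergent power series -/

section series

/-- The power series `∑ a_n (z - z₀)^n` converges to `F` on the ball of radius `r`. -/
def HasSeries (F : GC → GC) (z₀ : GC) (r : ℝ) (a : ℕ → GC) : Prop :=
  ∀ z ∈ gball z₀ r, Tendsto (fun m => gnorm (partialSum a z₀ z m - F z)) atTop (𝓝 0)

variable {F : GC → GC} {z₀ : GC} {r : ℝ} {a : ℕ → GC}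

theorem HasSeries.tendsto_gnorm_coeff (h : HasSeries F z₀ r a) {ρ : ℝ} (hρ : Real.exp (-ρ) < r) :
    Tendsto (fun n => gnorm (a n) * Real.exp (-ρ) ^ n) atTop (𝓝 0) := by
  have hz : z₀ + alpha ρ ∈ gball z₀ r := by
    change gnorm (z₀ + alpha ρ - z₀) < r
    rw [add_sub_cancel_left]
    exact (gnorm_alpha_le ρ).trans_lt hρ
  have h1 := h _ hz
  have h2 := (tendsto_add_atTop_iff_nat 1).2 h1
  have h3 := h2.max h1
  rw [max_self] at h3
  refine squeeze_zero (fun n => by have := gnorm_nonneg (a n); positivity) (fun n => ?_) h3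
  have e : alpha ρ ^ n * a n = (partialSum a z₀ (z₀ + alpha ρ) (n + 1) - F (z₀ + alpha ρ)) -
      (partialSum a z₀ (z₀ + alpha ρ) n - F (z₀ + alpha ρ)) := by
    rw [partialSum, partialSum, Finset.sum_range_succ, add_sub_cancel_left]
    ring
  rw [mul_comm, ← gnorm_alpha_pow_mul, e]
  exact gnorm_sub_le_of_le (le_max_left _ _) (le_max_right _ _)

theorem HasSeries.gnorm_sub_coeff_zero (h : HasSeries F z₀ r a) (hr : 0 < r) :
    gnorm (a 0 - F z₀) = 0 := by
  have h1 := h z₀ (by simpa [gball, gnorm_zero] using hr)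
  refine tendsto_nhds_unique ((tendsto_congr' ?_).1 h1) tendsto_const_nhds |>.symm ▸ rfl
  filter_upwards [eventually_ge_atTop 1] with m hm
  obtain ⟨k, rfl⟩ : ∃ k, m = k + 1 := ⟨m - 1, by omega⟩
  simp [partialSum, Finset.sum_range_succ']

/-- Second order remainder of the power function, in the ultrametric setting. -/
theorem gnorm_add_pow_sub_le {k h : GC} {s t : ℝ} (hs : 0 < s) (hk : gnorm k ≤ s)
    (hh : gnorm h ≤ t) (hts : t ≤ s) (n : ℕ) :
    gnorm ((k + h) ^ n - k ^ n - n * k ^ (n - 1) * h) ≤ s ^ n * (t ^ 2 / s ^ 2) := by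
  have ht : 0 ≤ t := (gnorm_nonneg h).trans hh
  induction n with
  | zero =>
    simp only [pow_zero, sub_self, Nat.cast_zero, zero_mul, gnorm_zero]
    positivity
  | succ n ih =>
    have e : (k + h) ^ (n + 1) - k ^ (n + 1) - (n + 1 : ℕ) * k ^ (n + 1 - 1) * h =
        (k + h) * ((k + h) ^ n - k ^ n - n * k ^ (n - 1) * h) + n * (k ^ (n - 1) * h ^ 2) := by
      rcases n with _ | n
      · simp
      · simp only [Nat.add_sub_cancel]
        push_cast
        ring
    rw [e]
    refine gnorm_add_le_of_le ?_ ?_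
    · rw [pow_succ' s, mul_assoc s]
      exact gnorm_mul_le_of_le (gnorm_add_le_of_le hk (hh.trans hts)) ih
    · rcases n with _ | n
      · simp only [Nat.cast_zero, zero_mul, gnorm_zero]
        positivity
      · refine (gnorm_natCast_mul_le _ _).trans ?_
        have h1 : gnorm (k ^ (n + 1 - 1)) ≤ s ^ n :=
          (gnorm_pow_le _ _).trans (pow_le_pow_left₀ (gnorm_nonneg _) hk n)
        have h2 : gnorm (h ^ 2) ≤ t ^ 2 :=
          (gnorm_pow_le _ _).trans (pow_le_pow_left₀ (gnorm_nonneg _) hh 2)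
        refine (gnorm_mul_le_of_le h1 h2).trans (le_of_eq ?_)
        field_simp
        ring

theorem gnorm_partialSum_add_sub_le {z h : GC} {s t B : ℝ} (hs : 0 < s)
    (hB : ∀ n, gnorm (a n) * s ^ n ≤ B) (hz : gnorm (z - z₀) ≤ s) (hh : gnorm h ≤ t)
    (hts : t ≤ s) (m : ℕ) :
    gnorm (partialSum a z₀ (z + h) (m + 1) - partialSum a z₀ z (m + 1) -
      partialSum (fun n => (n + 1 : ℕ) * a (n + 1)) z₀ z m * h) ≤ B / s ^ 2 * t ^ 2 := by
  have hB0 : 0 ≤ B := le_trans (by have := gnorm_nonneg (a 0); positivity) (hB 0)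
  have e : partialSum (fun n => (n + 1 : ℕ) * a (n + 1)) z₀ z m =
      ∑ n ∈ Finset.range (m + 1), n * a n * (z - z₀) ^ (n - 1) := by
    rw [Finset.sum_range_succ']
    simp [partialSum]
  rw [e, partialSum, partialSum, Finset.sum_mul, ← Finset.sum_sub_distrib,
    ← Finset.sum_sub_distrib]
  refine gnorm_sum_le _ _ (by positivity) fun n _ => ?_
  have e2 : a n * (z + h - z₀) ^ n - a n * (z - z₀) ^ n - n * a n * (z - z₀) ^ (n - 1) * h =
      a n * ((z - z₀ + h) ^ n - (z - z₀) ^ n - n * (z - z₀) ^ (n - 1) * h) := by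
    rw [add_sub_right_comm]
    ring
  rw [e2]
  refine (gnorm_mul_le_of_le le_rfl (gnorm_add_pow_sub_le hs hz hh hts n)).trans ?_
  calc _ = gnorm (a n) * s ^ n * (t ^ 2 / s ^ 2) := by ring
    _ ≤ B * (t ^ 2 / s ^ 2) := by have := hB n; gcongr
    _ = _ := by ring

end series

section analytic

variable {Ω : TopologicalSpace.Opens ℂ}

/-- If `κ(u)` is the sum of a power series, then the differentiated series converges to `κ(∂u)`.
Testing the expansions with the increments `α̇_ρ` and `i α̇_ρ` separates `∂u` from `∂̄u`. -/
theorem HasSeries.kappa_dzEM {u : EM Ω} {z₀ : GC} {r : ℝ} {a : ℕ → GC}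
    (h : HasSeries (kappa (clF u)) z₀ r a) (hz₀ : z₀ ∈ compactPoints Ω) {s : ℝ} (hs : 0 < s)
    (hsr : s < r) (hs1 : s < 1) :
    HasSeries (kappa (clF (dzEM u))) z₀ s (fun n => (n + 1 : ℕ) * a (n + 1)) := by
  intro z hz
  have hz' : gnorm (z - z₀) < s := hz
  have hzc : z ∈ compactPoints Ω := gball_subset_compactPoints hz₀ hs1 hz
  obtain ⟨B, hB⟩ : ∃ B, ∀ n, gnorm (a n) * s ^ n ≤ B := by
    have h1 := h.tendsto_gnorm_coeff (ρ := -Real.log s) (by rwa [neg_neg, Real.exp_log hs])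
    rw [neg_neg, Real.exp_log hs] at h1
    obtain ⟨B, hB⟩ := h1.bddAbove_range
    exact ⟨B, fun n => hB ⟨n, rfl⟩⟩
  obtain ⟨C, hC, hC'⟩ := exists_gnorm_kappa_add_alpha_le u hzc
  set D := kappa (clF (dzEM u)) z
  set D' := kappa (clF (dzbarEM u)) z
  set S := fun m => partialSum (fun n => ((n + 1 : ℕ) : GC) * a (n + 1)) z₀ z m with hS
  have key : ∀ c : ℂ, c ≠ 0 → ∀ η > 0, ∀ᶠ m in atTop,
      gnorm (algebraMap ℂ GC c * S m - (algebraMap ℂ GC c * D +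
        algebraMap ℂ GC ((starRingEnd ℂ) c) * D')) ≤ η := by
    intro c hc η hη
    set Q := max (max C (B / s ^ 2)) 1 with hQ
    have hQ0 : 0 < Q := one_pos.trans_le (le_max_right _ _)
    obtain ⟨t, ht0, hts, htη⟩ : ∃ t > 0, t < s ∧ Q * t ≤ η := by
      refine ⟨min (s / 2) (η / Q), by positivity, (min_le_left _ _).trans_lt (by linarith), ?_⟩
      calc _ ≤ Q * (η / Q) := by gcongr; exact min_le_right _ _
        _ = η := by field_simp
    obtain ⟨ρ, hρ, hρt⟩ : ∃ ρ > 0, Real.exp (-ρ) = t :=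
      ⟨-Real.log t, neg_pos.2 (Real.log_neg ht0 (hts.trans hs1)), by
        rw [neg_neg, Real.exp_log ht0]⟩
    set k := algebraMap ℂ GC c * alpha ρ with hk
    have hkt : gnorm k ≤ t := (gnorm_algebraMap_mul_le _ _).trans (hρt ▸ gnorm_alpha_le ρ)
    have hzk : z + k ∈ gball z₀ r := by
      change gnorm (z + k - z₀) < r
      rw [add_sub_right_comm]
      exact (gnorm_add_le_of_le hz'.le (hkt.trans hts.le)).trans_lt hsr
    have h1 := ((tendsto_add_atTop_iff_nat 1).2 (h _ hzk)).eventually_le_const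
      (show 0 < t ^ 2 by positivity)
    have h2 := ((tendsto_add_atTop_iff_nat 1).2 (h z (hz'.trans hsr))).eventually_le_const
      (show 0 < t ^ 2 by positivity)
    filter_upwards [h1, h2] with m h1 h2
    have h3 := gnorm_partialSum_add_sub_le hs hB hz'.le hkt hts.le m
    have h4 := hC' ρ hρ c
    rw [hρt] at h4
    have q1 : t ^ 2 ≤ Q * t ^ 2 := le_mul_of_one_le_left (by positivity) (le_max_right _ _)
    have q2 : C * t ^ 2 ≤ Q * t ^ 2 := by
      gcongr
      exact (le_max_left _ _).trans (le_max_left _ _)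
    have q3 : B / s ^ 2 * t ^ 2 ≤ Q * t ^ 2 := by
      gcongr
      exact (le_max_right _ _).trans (le_max_left _ _)
    have h5 := gnorm_sub_le_of_le (gnorm_add_le_of_le (h4.trans q2) (gnorm_sub_le_of_le
      (h1.trans q1) (h2.trans q1))) (h3.trans q3)
    have e : alpha ρ * (algebraMap ℂ GC c * S m - (algebraMap ℂ GC c * D +
        algebraMap ℂ GC ((starRingEnd ℂ) c) * D')) = S m * k - alpha ρ * (algebraMap ℂ GC c * D +
        algebraMap ℂ GC ((starRingEnd ℂ) c) * D') := by
      rw [hk]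
      ring
    have h6 : gnorm (alpha ρ * (algebraMap ℂ GC c * S m - (algebraMap ℂ GC c * D +
        algebraMap ℂ GC ((starRingEnd ℂ) c) * D'))) ≤ Q * t ^ 2 := by
      rw [e]
      convert h5 using 2
      simp only [hS]
      ring
    rw [gnorm_alpha_mul, hρt] at h6
    refine le_trans ?_ htη
    rw [← mul_le_mul_iff_right₀ ht0]
    exact h6.trans (le_of_eq (by ring))
  rw [Metric.tendsto_nhds]
  intro η hη
  filter_upwards [key 1 one_ne_zero (η / 2) (by positivity),
    key Complex.I Complex.I_ne_zero (η / 2) (by positivity)] with m h1 h2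
  rw [Real.dist_eq, sub_zero, abs_of_nonneg (gnorm_nonneg _)]
  have h3 := (gnorm_algebraMap_mul_le (-Complex.I) _).trans h2
  have h4 := gnorm_add_le_of_le h1 h3
  have e : algebraMap ℂ GC 1 * S m - (algebraMap ℂ GC 1 * D +
        algebraMap ℂ GC ((starRingEnd ℂ) 1) * D') + algebraMap ℂ GC (-Complex.I) *
        (algebraMap ℂ GC Complex.I * S m - (algebraMap ℂ GC Complex.I * D +
        algebraMap ℂ GC ((starRingEnd ℂ) Complex.I) * D')) = algebraMap ℂ GC 2 * (S m - D) := by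
    have hI : algebraMap ℂ GC Complex.I * algebraMap ℂ GC Complex.I = -1 := by
      simpa using algebraMap_I_mul_I 1
    simp only [map_one, Complex.conj_I, map_neg, map_ofNat]
    linear_combination (-(S m - D) - D') * hI
  rw [e, gnorm_algebraMap_mul two_ne_zero] at h4
  exact h4.trans_lt (by linarith)

/-- The derivatives `κ(∂^n u)(z₀)` are integer multiples of the coefficients of a power series for
`κ(u)`, up to elements of norm zero. -/
theorem HasSeries.gnorm_kappa_iterate_le {u : EM Ω} {z₀ : GC} {r : ℝ} {a : ℕ → GC}
    (h : HasSeries (kappa (clF u)) z₀ r a) (hr : 0 < r) (hz₀ : z₀ ∈ compactPoints Ω) (n : ℕ) :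
    gnorm (kappa (clF (dzEM^[n] u)) z₀) ≤ gnorm (a n) := by
  have key : ∀ n : ℕ, ∃ s > 0, ∃ c : ℕ → ℕ,
      HasSeries (kappa (clF (dzEM^[n] u))) z₀ s (fun j => c j * a (j + n)) := by
    intro n
    induction n with
    | zero => exact ⟨r, hr, fun _ => 1, by simpa using h⟩
    | succ n ih =>
      obtain ⟨s, hs, c, hc⟩ := ih
      refine ⟨min (s / 2) (1 / 2), by positivity, fun j => (j + 1) * c (j + 1), ?_⟩
      have := hc.kappa_dzEM hz₀ (s := min (s / 2) (1 / 2)) (by positivity)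
        ((min_le_left _ _).trans_lt (by linarith)) ((min_le_right _ _).trans_lt (by norm_num))
      rw [Function.iterate_succ_apply']
      convert this using 2 with j
      rw [show j + 1 + n = j + (n + 1) by omega]
      push_cast
      ring
  obtain ⟨s, hs, c, hc⟩ := key n
  have h1 := hc.gnorm_sub_coeff_zero hs
  rw [zero_add] at h1
  have h2 := gnorm_sub_le_of_le (gnorm_natCast_mul_le (c 0) (a n))
    (h1.le.trans (gnorm_nonneg (a n)))
  rwa [sub_sub_cancel] at h2

theorem isSubLinear_of_isAnalytic {f : G Ω} (h : IsAnalytic (compactPoints Ω) (kappa f)) :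
    IsSubLinear f := by
  obtain ⟨u, rfl⟩ : ∃ u, clF u = f := Ideal.Quotient.mk_surjective f
  refine ⟨u, rfl, fun x hx => ?_⟩
  obtain ⟨r, hr, -, a, ha⟩ := h x hx
  have ha : HasSeries (kappa (clF u)) x r a := ha
  have hest := ha.gnorm_kappa_iterate_le hr hx
  obtain ⟨ρ, hρ⟩ : ∃ ρ : ℝ, Real.exp (-ρ) < r :=
    ⟨-Real.log (r / 2), by rw [neg_neg, Real.exp_log (by positivity)]; linarith⟩
  have hlim := ha.tendsto_gnorm_coeff hρ
  obtain ⟨v, rfl, hv⟩ := hx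
  -- the summand `exp (-n)` keeps the logarithm finite when `a n` has norm zero
  set b : ℕ → ℝ := fun n => gnorm (a n) * Real.exp (-ρ) ^ n + Real.exp (-n) with hb
  have hb0 : ∀ n, 0 < b n := fun n => by
    have := gnorm_nonneg (a n)
    positivity
  have hblim : Tendsto b atTop (𝓝 0) := by
    have h1 : Tendsto (fun n : ℕ => Real.exp (-(n : ℝ))) atTop (𝓝 0) :=
      Real.tendsto_exp_neg_atTop_nhds_zero.comp tendsto_natCast_atTop_atTop
    simpa using hlim.add h1
  refine ⟨v, rfl, hv.1, ρ, fun n => -Real.log (b n) - ρ * n, ?_, fun n => ?_⟩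
  · simp only [sub_add_cancel]
    exact tendsto_neg_atBot_atTop.comp (Real.tendsto_log_nhdsGT_zero.comp
      (tendsto_nhdsWithin_iff.2 ⟨hblim, Eventually.of_forall hb0⟩))
  · have h1 := hest n
    rw [kappa_cl _ v hv] at h1
    have h2 : gnorm (a n) < Real.exp (-(-Real.log (b n) - ρ * n)) := by
      have e : -(-Real.log (b n) - ρ * n) = Real.log (b n) + n * ρ := by ring
      have e2 : Real.exp (-ρ) ^ n * Real.exp (n * ρ) = 1 := by
        rw [← Real.exp_nat_mul, ← Real.exp_add]
        simp
      rw [e, Real.exp_add, Real.exp_log (hb0 n), hb, add_mul, mul_assoc, e2, mul_one]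
      exact lt_add_of_pos_right _ (by positivity)
    have h3 := hasOrder_of_gnorm_lt (h1.trans_lt h2)
    have e : (pointEval (dzEM^[n] u) v hv).1 = fun φ => dz^[n] (u.1 φ) (v.1 φ) := by
      ext φ
      rw [← dzEM_iterate_apply]
      rfl
    rw [e] at h3
    exact h3

end analytic

end Colombeau

theorem mainTheorem4 (Ω : TopologicalSpace.Opens ℂ) (hΩ : (Ω : Set ℂ).Nonempty)
    (f : Colombeau.G Ω) :
    (Colombeau.IsAnalytic (Colombeau.compactPoints Ω) (Colombeau.kappa f) →
      Colombeau.IsSubLinear f) ∧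
    (Colombeau.IsHolomorphic f → Colombeau.IsSubLinear f →
      Colombeau.IsAnalytic (Colombeau.compactPoints Ω) (Colombeau.kappa f) ∧
      (∃ D : ℕ → Colombeau.GC → Colombeau.GC,
        Colombeau.IsDerivSeq (Colombeau.compactPoints Ω) (Colombeau.kappa f) D ∧
        ∀ z₀ ∈ Colombeau.compactPoints Ω, ∃ r : ℝ, 0 < r ∧ r < 1 ∧
          Colombeau.gball z₀ r ⊆ Colombeau.compactPoints Ω ∧
          Colombeau.ConvergesUniformlyTo (Colombeau.gball z₀ r)
            (fun n => algebraMap ℂ Colombeau.GC (1 / (n.factorial : ℂ)) * D n z₀) z₀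
            (Colombeau.kappa f)) ∧
      ∀ z₀ ∈ Colombeau.compactPoints Ω,
        Colombeau.HasGDzbar (Colombeau.compactPoints Ω) (Colombeau.kappa f) z₀ 0) := by
  refine ⟨Colombeau.isSubLinear_of_isAnalytic, fun hf _ => ?_⟩
  obtain ⟨u, rfl⟩ : ∃ u, Colombeau.clF u = f := Ideal.Quotient.mk_surjective f
  have hu := hf.isHolFamily
  have hr : Real.exp (-1) < 1 := by simp
  refine ⟨fun z₀ hz₀ => ?_, ⟨fun n => Colombeau.kappa (Colombeau.clF (Colombeau.dzEM^[n] u)),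
    ⟨fun _ _ => rfl, fun n z hz => ?_⟩, fun z₀ hz₀ => ?_⟩, fun z₀ hz₀ => ?_⟩
  · exact ⟨_, Real.exp_pos (-1), Colombeau.gball_subset_compactPoints hz₀ hr, _,
      fun z hz => (hu.convergesUniformlyTo hz₀).tendsto hz⟩
  · beta_reduce
    rw [Function.iterate_succ_apply']
    exact (hu.iterate n).hasGDeriv hz
  · exact ⟨_, Real.exp_pos (-1), hr, Colombeau.gball_subset_compactPoints hz₀ hr,
      hu.convergesUniformlyTo hz₀⟩
  · exact (hu.hasGDeriv hz₀).hasGDzbar_zero
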